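/- Let $r>0$, $T>0$, $X=\mathbb R\times L^2([-r,0])$ with $\langle x,y\rangle=x_0y_0+\int_{-r}^0x_1(\xi)y_1(\xi)\,d\xi$. Let $W_0$ be a real Brownian motion on a probability space $(\Omega,\mathcal F,\mathbb P)$ and $\mathbb F=(\mathcal F_t)_{t\ge0}$ the completion of its natural filtration. Let $U\subseteq[0,\infty)$ be a nonempty compact interval and $\mathcal U$ the set of (jointly measurable) $\mathbb F$-adapted processes $z=(z(t))_{t\in[0,T]}$ with values in $U$. Let $a_0\le 0$, $b_0\ge0$, $\sigma\in\mathbb R$, $a_1\in L^2([-r,0])$, and let $b_1,\delta\in L^2([-r,0])$ be nonnegative. Let $\varphi_0:\mathbb R\to\mathbb R$ and $h_0:[0,\infty)\to[0,\infty)$ be measurable with $|\varphi_0(y)|\le K(1+|y|)^m$ for all $y\in\mathbb R$ and $|h_0(u)|\le K$ for all $u\in U$, for some $K>0$, $m\ge0$. Define $\varphi:X\to\mathbb R$, $\varphi(x_0,x_1)=\varphi_0(x_0)$, and $h:U\to\mathbb R$, $h=-h_0$. For $s\in[0,T]$, $x=(x_0,x_1)\in X$ and $z\in\mathcal U$ let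 $y^{s,x,z}$ be the continuous adapted solution on $[s,T]$ of $$dy(t)=\Big[a_0y(t)+\int_{-r}^0a_1(\xi)y(t+\xi)\,d\xi+b_0z(t)+\int_{-r}^0b_1(\xi)z(t+\xi)\,d\xi\Big]dt+\sigma\,dW_0(t),$$ with $y(s)=x_0$ and, in place of the values of $y$ and $z$ before time $s$, $y(s+\xi)=x_1(\xi)$ and $z(s+\xi)=\delta(\xi)$ for $\xi\in[-r,0)$. Put $$V(s,x)=\sup_{z\in\mathcal U}\mathbb E\Big[\varphi_0(y^{s,x,z}(T))-\int_s^Th_0(z(t))\,dt\Big].$$ Let further $A(x_0,x_1)=(a_0x_0+x_1(0),\,a_1x_0-x_1')$ with domain $D(A)=\{x\in X: x_1\in W^{1,2}([-r,0]),\ x_1(-r)=0\}$, $Bu=(b_0u,b_1u)$, $Gc=(\sigma c,0)$. For $x\in X$ let $Y^{s,x,z}$ be the $X$-valued continuous adapted weak solution on $[s,T]$ of $dY=(AY+Bz)\,dt+G\,dW_0$, $Y(s)=x$ (that is, almost surely, $\langle Y(t),\eta\rangle=\langle x,\eta\rangle+\int_s^t(\langle Y(u),A^*\eta\rangle+\langle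 Bz(u),\eta\rangle)\,du+\langle G(W_0(t)-W_0(s)),\eta\rangle$ for all $\eta\in D(A^*)$, $t\in[s,T]$), and put $$\mathcal V(s,x)=\sup_{z\in\mathcal U}\mathbb E\Big[\varphi(Y^{s,x,z}(T))+\int_s^Th(z(t))\,dt\Big].$$ If $\varphi$ is concave on $X$ and $h$ is concave on $U$, then for every $s\in[0,T]$ the functions $x\mapsto V(s,x)$ and $x\mapsto\mathcal V(s,x)$ are proper concave on $X$, i.e. they never take the value $+\infty$, are not identically $-\infty$, and have a convex hypograph. -/

import Mathlib

open MeasureTheory ProbabilityTheory Set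
open scoped NNReal ENNReal

noncomputable section

/-- The real Hilbert space `L²([-r,0])`. -/
abbrev DelayL2 (r : ℝ) : Type := Lp ℝ 2 (volume.restrict (Icc (-r) 0))

/-- The Hilbert space `X = ℝ × L²([-r,0])` with inner product
`⟪x, y⟫ = x₀ y₀ + ∫_{-r}^0 x₁ y₁`. -/
abbrev StateX (r : ℝ) : Type := WithLp 2 (ℝ × DelayL2 r)

/-- The data of the advertising model: delay length `r`, horizon `T`, coefficients of the state
equation, initial advertising trajectory `δ`, end points of the compact control interval, reward
`φ₀` of the terminal goodwill and running cost `h₀` (only the values of `h₀` on `[0,∞)` matter).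
The sign, measurability and growth conditions are stated separately. -/
structure GoodwillModel where
  r : ℝ
  T : ℝ
  a₀ : ℝ
  b₀ : ℝ
  σ : ℝ
  a₁ : DelayL2 r
  b₁ : DelayL2 r
  δ : DelayL2 r
  uMin : ℝ
  uMax : ℝ
  φ₀ : ℝ → ℝ
  h₀ : ℝ → ℝ

/-- The trajectory on the whole time axis that follows the initial history `p` (a function of
`ξ ∈ [-r,0]`) before time `s` and the path `f` from time `s` on. -/
def withHistory (s : ℝ) (p f : ℝ → ℝ) (τ : ℝ) : ℝ :=
  if τ < s then p (τ - s) else f τ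

/-- The filtration generated by the process `W`, completed by the null sets of `P`. -/
def completedFiltration {Ω : Type*} [m : MeasurableSpace Ω] (P : Measure Ω) (W : ℝ≥0 → Ω → ℝ)
    (hW : ∀ t, StronglyMeasurable (W t)) : Filtration ℝ≥0 m :=
  Filtration.natural W hW ⊔
    Filtration.const ℝ≥0 (MeasurableSpace.generateFrom {A : Set Ω | MeasurableSet A ∧ P A = 0})
      (MeasurableSpace.generateFrom_le fun _ hA => hA.1)

/-- A function `f : E → [-∞, ∞]` is proper concave: it never takes the value `+∞`, it is not
identically `-∞`, and its hypograph is convex. -/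
def ProperConcave {E : Type*} [AddCommGroup E] [Module ℝ E] (f : E → EReal) : Prop :=
  (∀ x, f x ≠ ⊤) ∧ (∃ x, f x ≠ ⊥) ∧ Convex ℝ {p : E × ℝ | (p.2 : EReal) ≤ f p.1}

/-- `w` is the absolutely continuous representative on `[-r,0]` of `f`, and `g ∈ L²([-r,0])` is
the weak derivative of `f`; thus `f ∈ W^{1,2}([-r,0])`. -/
def IsSobolevRep {r : ℝ} (f : DelayL2 r) (w : ℝ → ℝ) (g : DelayL2 r) : Prop :=
  (f =ᵐ[volume.restrict (Icc (-r) 0)] w) ∧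
    ∀ ξ ∈ Icc (-r) 0, w ξ = w (-r) + ∫ ζ in (-r)..ξ, g ζ

namespace GoodwillModel

variable (M : GoodwillModel)

/-- The compact control interval. -/
def U : Set ℝ := Icc M.uMin M.uMax

/-- The reward as a function on `X`. -/
def φ (x : StateX M.r) : ℝ := M.φ₀ x.fst

/-- The running reward. -/
def h (u : ℝ) : ℝ := -M.h₀ u

variable {Ω : Type*} [MeasurableSpace Ω] (P : Measure Ω) (W : ℝ≥0 → Ω → ℝ)
  (hW : ∀ t, StronglyMeasurable (W t))

/-- Admissible controls: jointly measurable processes on `[0,T]`, adapted to the completed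
filtration of `W`, with values in the control interval. -/
structure IsControl (z : ℝ → Ω → ℝ) : Prop where
  measurable : Measurable fun p : Icc (0 : ℝ) M.T × Ω => z p.1 p.2
  adapted : ∀ t ∈ Icc 0 M.T, Measurable[completedFiltration P W hW t.toNNReal] (z t)
  mem : ∀ t ∈ Icc 0 M.T, ∀ ω, z t ω ∈ M.U

/-! ### The stochastic delay differential equation -/

/-- The drift of the goodwill stock at time `u ≥ s`, along the goodwill path `y` and the control
path `z` (functions of time from `s` on), with initial goodwill history `x₁` and initial
advertising history `δ`. -/
def delayDrift (s : ℝ) (x₁ : DelayL2 M.r) (z y : ℝ → ℝ) (u : ℝ) : ℝ :=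
  M.a₀ * y u + (∫ ξ in (-M.r)..0, M.a₁ ξ * withHistory s x₁ y (u + ξ)) +
    M.b₀ * z u + ∫ ξ in (-M.r)..0, M.b₁ ξ * withHistory s M.δ z (u + ξ)

/-- `y` is a continuous adapted solution on `[s,T]` of the stochastic delay differential equation
with control `z`, initial goodwill `x₀ = x.fst` and initial goodwill history `x₁ = x.snd`. -/
structure IsDelaySolution (s : ℝ) (x : StateX M.r) (z y : ℝ → Ω → ℝ) : Prop where
  adapted : ∀ t ∈ Icc s M.T, Measurable[completedFiltration P W hW t.toNNReal] (y t)
  continuous : ∀ᵐ ω ∂P, ContinuousOn (fun t => y t ω) (Icc s M.T)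
  eqn : ∀ᵐ ω ∂P, ∀ t ∈ Icc s M.T,
    y t ω = x.fst + (∫ u in s..t, M.delayDrift s x.snd (fun τ => z τ ω) (fun τ => y τ ω) u) +
      M.σ * (W t.toNNReal ω - W s.toNNReal ω)

/-- The objective functional `𝔼[φ₀(y(T)) - ∫_s^T h₀(z(t)) dt]`. -/
def objective (s : ℝ) (z y : ℝ → Ω → ℝ) : ℝ :=
  ∫ ω, (M.φ₀ (y M.T ω) - ∫ t in s..M.T, M.h₀ (z t ω)) ∂P

/-- The value function of the delay problem: the supremum of the objective functional over all
admissible controls `z`, where `y` is the (up to null sets unique) solution driven by `z`. -/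
def value (s : ℝ) (x : StateX M.r) : EReal :=
  ⨆ (z : ℝ → Ω → ℝ) (_ : M.IsControl P W hW z)
    (y : ℝ → Ω → ℝ) (_ : M.IsDelaySolution P W hW s x z y), (M.objective P s z y : EReal)

/-! ### The reformulation as an evolution equation in `X` -/

/-- The graph of the operator `A`: `x ∈ D(A)`, that is `x₁ ∈ W^{1,2}([-r,0])` with `x₁(-r) = 0`,
and `v = A x = (a₀ x₀ + x₁(0), a₁ x₀ - x₁')`. -/
def IsGen (x v : StateX M.r) : Prop :=
  ∃ (w : ℝ → ℝ) (g : DelayL2 M.r), IsSobolevRep x.snd w g ∧ w (-M.r) = 0 ∧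
    v.fst = M.a₀ * x.fst + w 0 ∧ v.snd = x.fst • M.a₁ - g

/-- The graph of the adjoint operator: `η ∈ D(A*)` and `ζ = A* η`, that is
`⟪A x, η⟫ = ⟪x, ζ⟫` for all `x ∈ D(A)`. -/
def IsGenAdjoint (η ζ : StateX M.r) : Prop :=
  ∀ x v : StateX M.r, M.IsGen x v → inner ℝ v η = inner ℝ x ζ

/-- The control operator `B u = (b₀ u, b₁ u)`. -/
def B (u : ℝ) : StateX M.r := WithLp.toLp 2 (M.b₀ * u, u • M.b₁)

/-- The noise operator `G c = (σ c, 0)`. -/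
def G (c : ℝ) : StateX M.r := WithLp.toLp 2 (M.σ * c, 0)

/-- `Y` is a continuous adapted weak solution on `[s,T]` of the evolution equation
`dY = (A Y + B z) dt + G dW`, `Y(s) = x`, in `X`. -/
structure IsWeakSolution (s : ℝ) (x : StateX M.r) (z : ℝ → Ω → ℝ) (Y : ℝ → Ω → StateX M.r) :
    Prop where
  adapted : ∀ t ∈ Icc s M.T,
    StronglyMeasurable[completedFiltration P W hW t.toNNReal] (Y t)
  continuous : ∀ᵐ ω ∂P, ContinuousOn (fun t => Y t ω) (Icc s M.T)
  eqn : ∀ᵐ ω ∂P, ∀ η ζ : StateX M.r, M.IsGenAdjoint η ζ → ∀ t ∈ Icc s M.T,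
    inner ℝ (Y t ω) η = inner ℝ x η +
      (∫ u in s..t, (inner ℝ (Y u ω) ζ + inner ℝ (M.B (z u ω)) η)) +
      inner ℝ (M.G (W t.toNNReal ω - W s.toNNReal ω)) η

/-- The objective functional `𝔼[φ(Y(T)) + ∫_s^T h(z(t)) dt]`. -/
def objectiveX (s : ℝ) (z : ℝ → Ω → ℝ) (Y : ℝ → Ω → StateX M.r) : ℝ :=
  ∫ ω, (M.φ (Y M.T ω) + ∫ t in s..M.T, M.h (z t ω)) ∂P

/-- The value function of the reformulated problem, started at an arbitrary `x ∈ X`: the supremum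
over all admissible controls `z`, where `Y` is the (up to null sets unique) solution driven by
`z`. -/
def valueX (s : ℝ) (x : StateX M.r) : EReal :=
  ⨆ (z : ℝ → Ω → ℝ) (_ : M.IsControl P W hW z)
    (Y : ℝ → Ω → StateX M.r) (_ : M.IsWeakSolution P W hW s x z Y),
      (M.objectiveX P s z Y : EReal)

end GoodwillModel

end

/-! ### Scalar Volterra equations -/

section Volterra

open Filter Topology

/-! Concavity rests on the state equations being affine, jointly in the initial datum and the
control. If `y₁`, `y₂` are driven by `(x₁, z₁)`, `(x₂, z₂)` and `α + β = 1`, then `α y₁ + β y₂` is a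
solution driven by the combined data: the drift is linear in the histories, and the fixed history
`δ` and the noise reproduce themselves because the weights add up to one. The interval `U` is
convex, so the combined control is admissible, and concavity of the rewards bounds its objective
from below by the combination of the two objectives. Applied to nearly optimal pairs, this makes the
hypograph convex (`properConcave_iSup`). The suprema run over all solutions, so uniqueness is never
needed.

The value `+∞` is excluded by a bound uniform in the control. The goodwill solves a scalar Volterra
equation with continuous kernel `kern M.coeffA`, whose forcing is bounded uniformly over controls.
Grönwall's inequality then gives `|y(T)| ≤ C * noiseBound` with `C` independent of the control
(`exists_volterra_bound`). The noise functional has moments of all orders, the reward grows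
polynomially, and the running cost only lowers the objective.

For the delay equation the Volterra form comes from Fubini (`integral_delayDrift`). For the
evolution equation only pairings with `D(A*)` are available. There `A` is split as the transport
part `(x₁(0), -x₁')` plus the rank-one term `x₀ (a₀, a₁)`, which is treated as forcing. Integrating
along the dual characteristics (`inner_eq_of_transport`), with smooth cutoffs increasingly close to
the indicator of `[0,∞)`, yields the equation of the first component (`weak_fst_eq`).

The value is not identically `-∞` as soon as one solution exists. For a constant control the
Volterra equation is solved pathwise by a resolvent, which keeps adaptedness. In the state space the
weak solution is then written by variation of constants along orbits of the transport semigroup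
(`mildPath_eqn`). -/

lemma integrable_indicator_triangle {E : Type*} [NormedAddCommGroup E]
    {f : ℝ × ℝ → E} (hf : Continuous f) (s t : ℝ) :
    IntegrableOn ({p : ℝ × ℝ | p.2 ≤ p.1}.indicator f) (Ioc s t ×ˢ Ioc s t) := by
  refine Integrable.indicator ?_ (measurableSet_le measurable_snd measurable_fst)
  have h : IntegrableOn f (Icc s t ×ˢ Icc s t) (volume.prod volume) :=
    hf.continuousOn.integrableOn_compact (isCompact_Icc.prod isCompact_Icc)
  exact h.mono_set (prod_mono Ioc_subset_Icc_self Ioc_subset_Icc_self)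

/-- Dirichlet's formula for the order of integration over a triangle. -/
lemma intervalIntegral_triangle_swap {E : Type*} [NormedAddCommGroup E] [NormedSpace ℝ E]
    {f : ℝ × ℝ → E} (hf : Continuous f) {s t : ℝ} (hst : s ≤ t) :
    ∫ v in s..t, ∫ u in s..v, f (v, u) = ∫ u in s..t, ∫ v in u..t, f (v, u) := by
  have h1 : ∫ v in s..t, ∫ u in s..v, f (v, u)
      = ∫ v in s..t, ∫ u in s..t, {p : ℝ × ℝ | p.2 ≤ p.1}.indicator f (v, u) := by
    refine intervalIntegral.integral_congr fun v hv => ?_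
    rw [uIcc_of_le hst] at hv
    exact (intervalIntegral.integral_indicator (f := fun u => f (v, u)) hv).symm
  have h2 : ∫ u in s..t, ∫ v in u..t, f (v, u)
      = ∫ u in s..t, ∫ v in s..t, {p : ℝ × ℝ | p.2 ≤ p.1}.indicator f (v, u) := by
    refine intervalIntegral.integral_congr_ae (.of_forall fun u hu => ?_)
    rw [uIoc_of_le hst] at hu
    rw [intervalIntegral.integral_of_le hu.2, intervalIntegral.integral_of_le hst]
    have e : (fun v => {p : ℝ × ℝ | p.2 ≤ p.1}.indicator f (v, u))
        = (Ici u).indicator fun v => f (v, u) := by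
      ext v; simp [indicator]
    rw [e, setIntegral_indicator measurableSet_Ici, ← integral_Icc_eq_integral_Ioc]
    congr 2
    ext v
    simp only [mem_Icc, mem_inter_iff, mem_Ioc, mem_Ici]
    exact ⟨fun h => ⟨⟨hu.1.trans_le h.1, h.2⟩, h.1⟩, fun h => ⟨h.2, h.1.2⟩⟩
  rw [h1, h2]
  refine intervalIntegral_intervalIntegral_swap
    (F := fun v u => {p : ℝ × ℝ | p.2 ≤ p.1}.indicator f (v, u)) ?_
  rw [uIoc_of_le hst]
  exact integrable_indicator_triangle hf s t

/-- A continuous function satisfying a linear integral inequality is bounded by the forcing and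
its integral. -/
lemma le_of_le_add_mul_integral {y g : ℝ → ℝ} {L s T : ℝ} (hL : 0 ≤ L) (hsT : s ≤ T)
    (hy : ContinuousOn y (Icc s T)) (hg : ContinuousOn g (Icc s T)) (hg0 : ∀ t ∈ Icc s T, 0 ≤ g t)
    (h : ∀ t ∈ Icc s T, y t ≤ g t + L * ∫ u in s..t, y u) :
    y T ≤ g T + L * (Real.exp (L * (T - s)) * ∫ u in s..T, g u) := by
  refine (h T ⟨hsT, le_rfl⟩).trans ?_
  gcongr
  set Y : ℝ → ℝ := fun t => ∫ u in s..t, y u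
  set G : ℝ → ℝ := fun t => ∫ u in s..t, Real.exp (-L * (u - s)) * g u
  have hg' : ContinuousOn (fun u => Real.exp (-L * (u - s)) * g u) (Icc s T) := by fun_prop
  have int {q : ℝ → ℝ} (hq : ContinuousOn q (Icc s T)) : IntervalIntegrable q volume s T :=
    hq.intervalIntegrable_of_Icc hsT
  have cont {q : ℝ → ℝ} (hq : ContinuousOn q (Icc s T)) :
      ContinuousOn (fun t => ∫ u in s..t, q u) (Icc s T) := by
    have := intervalIntegral.continuousOn_primitive_interval (μ := volume) (f := q)
      (a := s) (b := T) (by rw [uIcc_of_le hsT]; exact hq.integrableOn_Icc)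
    rwa [uIcc_of_le hsT] at this
  have der {q : ℝ → ℝ} (hq : ContinuousOn q (Icc s T)) {t : ℝ} (ht : t ∈ Ioo s T) :
      HasDerivAt (fun t => ∫ u in s..t, q u) (q t) t := by
    have hc : ContinuousAt q t := hq.continuousAt (Icc_mem_nhds ht.1 ht.2)
    refine intervalIntegral.integral_hasDerivAt_right ((int hq).mono_set ?_) ?_ hc
    · rw [uIcc_of_le ht.1.le, uIcc_of_le hsT]; exact Icc_subset_Icc_right ht.2.le
    · exact ContinuousAt.stronglyMeasurableAtFilter isOpen_Ioo
        (fun x hx => hq.continuousAt (Icc_mem_nhds hx.1 hx.2)) t ht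
  -- Integrating factor: the derivative of this function is `exp (-L (t - s))` times the defect in
  -- the assumed inequality, hence nonpositive.
  have hanti : AntitoneOn (fun t => Real.exp (-L * (t - s)) * Y t - G t) (Icc s T) := by
    have hd : ∀ t ∈ Ioo s T, HasDerivAt (fun t => Real.exp (-L * (t - s)) * Y t - G t)
        (Real.exp (-L * (t - s)) * (-L) * Y t + Real.exp (-L * (t - s)) * y t
          - Real.exp (-L * (t - s)) * g t) t := by
      intro t ht
      have he : HasDerivAt (fun t => Real.exp (-L * (t - s)))
          (Real.exp (-L * (t - s)) * (-L)) t := by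
        have : HasDerivAt (fun t => -L * (t - s)) (-L) t := by
          simpa using ((hasDerivAt_id t).sub_const s).const_mul (-L)
        exact this.exp
      exact (he.mul (der hy ht)).sub (der hg' ht)
    refine antitoneOn_of_deriv_nonpos (convex_Icc s T) ?_ ?_ ?_
    · exact (ContinuousOn.mul (by fun_prop) (cont hy)).sub (cont hg')
    · intro t ht
      rw [interior_Icc] at ht
      exact (hd t ht).differentiableAt.differentiableWithinAt
    · intro t ht
      rw [interior_Icc] at ht
      rw [(hd t ht).deriv]
      have := h t ⟨ht.1.le, ht.2.le⟩
      have e : Real.exp (-L * (t - s)) * (-L) * Y t + Real.exp (-L * (t - s)) * y t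
          - Real.exp (-L * (t - s)) * g t
          = Real.exp (-L * (t - s)) * (y t - (g t + L * ∫ u in s..t, y u)) := by
        simp only [Y]; ring
      rw [e]
      exact mul_nonpos_of_nonneg_of_nonpos (Real.exp_pos _).le (by linarith)
  have h0 := hanti ⟨le_rfl, hsT⟩ ⟨hsT, le_rfl⟩ hsT
  simp only [Y, G, intervalIntegral.integral_same, mul_zero, sub_zero] at h0
  -- The weight is at most one and `g` is nonnegative, so it can be dropped.
  have hGle : ∫ u in s..T, Real.exp (-L * (u - s)) * g u ≤ ∫ u in s..T, g u := by
    refine intervalIntegral.integral_mono_on hsT (int hg') (int hg) fun u hu => ?_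
    refine mul_le_of_le_one_left (hg0 u hu) (Real.exp_le_one_iff.2 ?_)
    have := mul_nonneg hL (sub_nonneg.2 hu.1)
    linarith
  have h1 : Real.exp (-L * (T - s)) * Y T ≤ ∫ u in s..T, g u := by
    simp only [Y]; linarith
  calc Y T = Real.exp (L * (T - s)) * (Real.exp (-L * (T - s)) * Y T) := by
        rw [← mul_assoc, ← Real.exp_add]; simp
    _ ≤ _ := by gcongr

/-- The resolvent of a continuous convolution kernel. -/
lemma exists_resolvent {k : ℝ → ℝ} (hk : Continuous k) {T : ℝ} (hT : 0 ≤ T) :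
    ∃ R : ℝ → ℝ, Continuous R ∧
      ∀ τ ∈ Icc 0 T, R τ = k τ + ∫ u in (0 : ℝ)..τ, k (τ - u) * R u := by
  obtain ⟨L, hL⟩ : ∃ L, ∀ τ ∈ Icc 0 T, ‖k τ‖ ≤ L :=
    isCompact_Icc.exists_bound_of_continuousOn hk.continuousOn
  have hL0 : 0 ≤ L := (norm_nonneg _).trans (hL 0 ⟨le_rfl, hT⟩)
  -- Exponential weight: multiplying by `exp (-l τ)` makes the convolution operator a contraction in
  -- the sup norm on all of `[0,T]`, with constant `L / l ≤ 1 / 2`. The extra `1` keeps `l` positive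
  -- when `L = 0`. The weight is undone after the fixed point is found.
  set l : ℝ := 2 * L + 1
  have hl : 0 < l := by positivity
  set kl : ℝ → ℝ := fun τ => Real.exp (-l * τ) * k τ
  have hkl : Continuous kl := by fun_prop
  let Φ : C(Icc 0 T, ℝ) → C(Icc 0 T, ℝ) := fun f =>
    ⟨fun τ => kl τ + ∫ u in (0 : ℝ)..τ, kl (τ - u) * IccExtend hT f u, by
      refine (hkl.comp continuous_subtype_val).add ?_
      have hc : Continuous (Function.uncurry fun (τ : Icc 0 T) (u : ℝ) =>
          kl (τ - u) * IccExtend hT f u) :=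
        (hkl.comp (by fun_prop)).mul
          ((f.continuous.Icc_extend').comp continuous_snd)
      exact intervalIntegral.continuous_parametric_intervalIntegral_of_continuous hc
        continuous_subtype_val⟩
  have hΦ : ContractingWith (1 / 2) Φ := by
    refine ⟨by rw [← NNReal.coe_lt_coe]; norm_num, LipschitzWith.of_dist_le_mul fun f g => ?_⟩
    rw [ContinuousMap.dist_le (by positivity)]
    intro τ
    have ci (f : C(Icc 0 T, ℝ)) :
        Continuous fun u => kl (τ - u) * IccExtend hT f u :=
      (hkl.comp (by fun_prop)).mul (f.continuous.Icc_extend')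
    have e : Φ f τ - Φ g τ = ∫ u in (0 : ℝ)..τ,
        kl (τ - u) * (IccExtend hT f u - IccExtend hT g u) := by
      change (kl τ + ∫ u in (0 : ℝ)..τ, kl (τ - u) * IccExtend hT f u)
        - (kl τ + ∫ u in (0 : ℝ)..τ, kl (τ - u) * IccExtend hT g u) = _
      rw [add_sub_add_left_eq_sub, ← intervalIntegral.integral_sub
        ((ci f).intervalIntegrable _ _) ((ci g).intervalIntegrable _ _)]
      simp only [mul_sub]
    rw [Real.dist_eq, e, ← Real.norm_eq_abs]
    have hb : ∀ u ∈ Ioc (0 : ℝ) τ,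
        ‖kl (τ - u) * (IccExtend hT f u - IccExtend hT g u)‖
          ≤ L * dist f g * Real.exp (-l * (τ - u)) := by
      intro u hu
      rw [norm_mul, norm_mul, Real.norm_eq_abs (Real.exp _), Real.abs_exp]
      have h1 : ‖k (τ - u)‖ ≤ L :=
        hL _ ⟨sub_nonneg.2 hu.2, by linarith [τ.2.2, hu.1]⟩
      have h2 : ‖IccExtend hT f u - IccExtend hT g u‖ ≤ dist f g := by
        rw [← dist_eq_norm]
        exact ContinuousMap.dist_apply_le_dist (f := f) (g := g) (projIcc 0 T hT u)
      calc _ ≤ Real.exp (-l * (τ - u)) * L * dist f g := by gcongr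
        _ = _ := by ring
    have hder : ∀ u ∈ uIcc (0 : ℝ) τ, HasDerivAt (fun u => l⁻¹ * Real.exp (-l * (τ - u)))
        (Real.exp (-l * (τ - u))) u := by
      intro u _
      have h1 : HasDerivAt (fun u : ℝ => -l * (τ - u)) l u := by
        simpa using ((hasDerivAt_id u).const_sub (τ : ℝ)).const_mul (-l)
      have h2 := (h1.exp).const_mul l⁻¹
      have e : l⁻¹ * (Real.exp (-l * (τ - u)) * l) = Real.exp (-l * (τ - u)) := by
        rw [mul_comm (Real.exp _), ← mul_assoc, inv_mul_cancel₀ hl.ne', one_mul]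
      rwa [e] at h2
    have hint : ∫ u in (0 : ℝ)..τ, Real.exp (-l * (τ - u)) ≤ l⁻¹ := by
      rw [intervalIntegral.integral_eq_sub_of_hasDerivAt hder
        (Continuous.intervalIntegrable (by fun_prop) _ _)]
      simp only [sub_self, mul_zero, Real.exp_zero, mul_one]
      have : 0 ≤ l⁻¹ * Real.exp (-l * (τ - 0)) := by positivity
      linarith
    calc _ ≤ ∫ u in (0 : ℝ)..τ, L * dist f g * Real.exp (-l * (τ - u)) :=
          intervalIntegral.norm_integral_le_of_norm_le τ.2.1 (ae_of_all _ hb)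
            (Continuous.intervalIntegrable (by fun_prop) _ _)
      _ = L * dist f g * ∫ u in (0 : ℝ)..τ, Real.exp (-l * (τ - u)) :=
          intervalIntegral.integral_const_mul _ _
      _ ≤ L * dist f g * l⁻¹ := by gcongr
      _ = (L * l⁻¹) * dist f g := by ring
      _ ≤ (1 / 2) * dist f g := by
          gcongr
          rw [← div_eq_mul_inv, div_le_div_iff₀ hl two_pos]
          simp only [l]; linarith
      _ = _ := by norm_num
  have : Nonempty C(Icc 0 T, ℝ) := ⟨0⟩
  set f := hΦ.fixedPoint with hf
  have hfix : Φ f = f := hΦ.fixedPoint_isFixedPt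
  refine ⟨fun τ => Real.exp (l * τ) * IccExtend hT f τ,
    (by fun_prop : Continuous fun τ => Real.exp (l * τ)).mul f.continuous.Icc_extend', ?_⟩
  intro τ hτ
  have e : IccExtend hT f τ = kl τ + ∫ u in (0 : ℝ)..τ, kl (τ - u) * IccExtend hT f u := by
    have := congrArg (fun F : C(Icc 0 T, ℝ) => F ⟨τ, hτ⟩) hfix
    rw [IccExtend_of_mem _ _ hτ]
    exact this.symm
  change Real.exp (l * τ) * IccExtend hT f τ = _
  rw [e, mul_add, ← intervalIntegral.integral_const_mul]
  congr 1
  · simp only [kl]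
    rw [← mul_assoc, ← Real.exp_add]; simp
  · refine intervalIntegral.integral_congr fun u _ => ?_
    simp only [kl]
    have : Real.exp (l * τ) * Real.exp (-l * (τ - u)) = Real.exp (l * u) := by
      rw [← Real.exp_add]; congr 1; ring
    calc _ = (Real.exp (l * τ) * Real.exp (-l * (τ - u))) * k (τ - u) * IccExtend hT f u := by ring
      _ = _ := by rw [this]; ring

/-- The solution of a Volterra equation given by the resolvent of its kernel. -/
lemma volterra_of_resolvent {k R F : ℝ → ℝ} (hk : Continuous k) (hR : Continuous R)
    (hF : Continuous F) {s T : ℝ}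
    (h : ∀ τ ∈ Icc 0 (T - s), R τ = k τ + ∫ u in (0 : ℝ)..τ, k (τ - u) * R u)
    {t : ℝ} (ht : t ∈ Icc s T) :
    F t + ∫ u in s..t, R (t - u) * F u
      = F t + ∫ u in s..t, k (t - u) * (F u + ∫ v in s..u, R (u - v) * F v) := by
  have hin : Continuous fun u => ∫ v in s..u, R (u - v) * F v :=
    intervalIntegral.continuous_parametric_intervalIntegral_of_continuous
      (f := fun u v => R (u - v) * F v)
      ((hR.comp (by fun_prop)).mul (hF.comp continuous_snd)) continuous_id
  have hswap : ∫ u in s..t, k (t - u) * ∫ v in s..u, R (u - v) * F v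
      = ∫ v in s..t, (∫ u in v..t, k (t - u) * R (u - v)) * F v := by
    have := intervalIntegral_triangle_swap
      (f := fun p : ℝ × ℝ => k (t - p.1) * (R (p.1 - p.2) * F p.2))
      ((hk.comp (by fun_prop)).mul ((hR.comp (by fun_prop)).mul (hF.comp continuous_snd))) ht.1
    simp only [intervalIntegral.integral_const_mul] at this
    rw [this]
    refine intervalIntegral.integral_congr fun v _ => ?_
    simp only [← mul_assoc, intervalIntegral.integral_mul_const]
  congr 1
  simp only [mul_add]
  have c1 : Continuous fun u => k (t - u) * F u := (hk.comp (by fun_prop)).mul hF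
  have c2 : Continuous fun u => k (t - u) * ∫ v in s..u, R (u - v) * F v :=
    (hk.comp (by fun_prop)).mul hin
  rw [intervalIntegral.integral_add (c1.intervalIntegrable _ _) (c2.intervalIntegrable _ _), hswap]
  -- The resolvent equation reads `k * R = R - k` for convolutions, so `k * (F + R * F)` collapses
  -- to `R * F`.
  have e : ∀ v ∈ Icc s t, ∫ u in v..t, k (t - u) * R (u - v) = R (t - v) - k (t - v) := by
    intro v hv
    rw [h (t - v) ⟨sub_nonneg.2 hv.2, by linarith [ht.2, hv.1]⟩, add_sub_cancel_left]
    have := intervalIntegral.integral_comp_sub_right (a := v) (b := t)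
      (fun u => k (t - v - u) * R u) v
    simp only [sub_self, sub_sub_sub_cancel_right] at this
    exact this
  have e2 : ∫ v in s..t, (∫ u in v..t, k (t - u) * R (u - v)) * F v
      = ∫ v in s..t, (R (t - v) * F v - k (t - v) * F v) := by
    refine intervalIntegral.integral_congr fun v hv => ?_
    rw [uIcc_of_le ht.1] at hv
    simp only [e v hv, sub_mul]
  rw [e2, intervalIntegral.integral_sub ?_ (c1.intervalIntegrable _ _)]
  · ring
  · exact Continuous.intervalIntegrable ((hR.comp (by fun_prop)).mul hF) _ _

end Volterra

noncomputable section

/-! ### Convolution with a history -/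

section Delay

variable {r : ℝ}

/-- Extension by zero of an element of `L²([-r,0])`. -/
def zext (a : DelayL2 r) : ℝ → ℝ := (Icc (-r) 0).indicator a

lemma measurable_zext (a : DelayL2 r) : Measurable (zext a) :=
  (Lp.stronglyMeasurable a).measurable.indicator measurableSet_Icc

lemma memLp_zext (a : DelayL2 r) : MemLp (zext a) 2 volume :=
  (memLp_indicator_iff_restrict measurableSet_Icc).2 (Lp.memLp a)

lemma integrable_zext (a : DelayL2 r) : Integrable (zext a) :=
  (integrable_indicator_iff measurableSet_Icc).2
    ((Lp.memLp a).integrable (by norm_num : (1 : ℝ≥0∞) ≤ 2))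

lemma zext_of_pos (a : DelayL2 r) {ξ : ℝ} (h : 0 < ξ) : zext a ξ = 0 :=
  indicator_of_notMem (fun hm => h.not_ge hm.2) _

lemma zext_congr {a : DelayL2 r} {f : ℝ → ℝ} (h : a =ᵐ[volume.restrict (Icc (-r) 0)] f) :
    zext a =ᵐ[volume] (Icc (-r) 0).indicator f := by
  have := (ae_restrict_iff' measurableSet_Icc).1 h
  filter_upwards [this] with ξ hξ
  by_cases hm : ξ ∈ Icc (-r) 0
  · simp [zext, hm, hξ hm]
  · simp [zext, hm]

lemma zext_combination (α β : ℝ) (a b : DelayL2 r) :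
    zext (α • a + β • b) =ᵐ[volume] fun ξ => α * zext a ξ + β * zext b ξ := by
  have h : ⇑(α • a + β • b) =ᵐ[volume.restrict (Icc (-r) 0)] fun ξ => α * a ξ + β * b ξ := by
    filter_upwards [Lp.coeFn_add (α • a) (β • b), Lp.coeFn_smul α a, Lp.coeFn_smul β b]
      with ξ h1 h2 h3
    rw [h1, Pi.add_apply, h2, h3]
    rfl
  refine (zext_congr h).trans (.of_forall fun ξ => ?_)
  by_cases hm : ξ ∈ Icc (-r) 0 <;> simp [zext, hm]

/-- Correlation of two functions on the line. -/
def corr (a f : ℝ → ℝ) (u : ℝ) : ℝ := ∫ ξ, a ξ * f (u + ξ)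

lemma intervalIntegral_mul_eq_zext (hr : 0 ≤ r) (a : DelayL2 r) (p : ℝ → ℝ) :
    ∫ ξ in (-r)..0, a ξ * p ξ = ∫ ξ, zext a ξ * p ξ := by
  rw [intervalIntegral.integral_of_le (by linarith), ← integral_Icc_eq_integral_Ioc,
    ← integral_indicator measurableSet_Icc]
  congr 1 with ξ
  by_cases hm : ξ ∈ Icc (-r) 0 <;> simp [zext, hm]

variable {a f g : ℝ → ℝ}

/-- The shear `(u, ξ) ↦ (u + ξ, ξ)` preserves Lebesgue measure and turns the integrand into a tensor
product of integrable functions. -/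
lemma integrable_corr_integrand (ha : Integrable a) (hf : Integrable f) :
    Integrable (fun p : ℝ × ℝ => a p.2 * f (p.1 + p.2)) (volume.prod volume) := by
  have h := hf.mul_prod ha
  have hm : MeasurePreserving (fun z : ℝ × ℝ => (z.1 + z.2, z.2)) (volume.prod volume)
      (volume.prod volume) := by
    simpa [add_comm] using measurePreserving_add_prod (volume : Measure ℝ) (volume : Measure ℝ)
  refine ((hm.integrable_comp h.aestronglyMeasurable).2 h).congr (.of_forall fun p => ?_)
  simp [mul_comm]

lemma ae_integrable_corr_integrand (ha : Integrable a) (hf : Integrable f) :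
    ∀ᵐ u : ℝ, Integrable fun ξ => a ξ * f (u + ξ) :=
  (integrable_corr_integrand ha hf).prod_right_ae

lemma integrable_corr (ha : Integrable a) (hf : Integrable f) : Integrable (corr a f) :=
  (integrable_corr_integrand ha hf).integral_prod_left

/-- Young's inequality in `L¹`, by Fubini and translation invariance. It later bounds the delayed
control terms uniformly over controls. -/
lemma integral_abs_corr_le (ha : Integrable a) (hf : Integrable f) :
    ∫ u, |corr a f u| ≤ (∫ ξ, |a ξ|) * ∫ v, |f v| := by
  have hi := (integrable_corr_integrand ha hf).norm
  calc ∫ u, |corr a f u| ≤ ∫ u, ∫ ξ, ‖a ξ * f (u + ξ)‖ :=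
        integral_mono (integrable_corr ha hf).abs hi.integral_prod_left
          fun u => norm_integral_le_integral_norm fun ξ => a ξ * f (u + ξ)
    _ = ∫ ξ, ∫ u, ‖a ξ * f (u + ξ)‖ := integral_integral_swap hi
    _ = ∫ ξ, |a ξ| * ∫ v, |f v| := by
        refine integral_congr_ae (.of_forall fun ξ => ?_)
        simp only [norm_mul, Real.norm_eq_abs, integral_const_mul]
        rw [integral_add_right_eq_self (fun v => |f v|) ξ]
    _ = _ := integral_mul_const _ _

/-- Translates of null sets are null, so the identity holds at every `u`. Linearity below holds only
for almost every `u`, where the slices are integrable; that is enough under a time integral. -/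
lemma corr_congr (h : f =ᵐ[volume] g) (u : ℝ) : corr a f u = corr a g u := by
  refine integral_congr_ae ?_
  have := (measurePreserving_add_left (volume : Measure ℝ) u).quasiMeasurePreserving.ae_eq_comp h
  filter_upwards [this] with ξ hξ
  simp only [Function.comp_apply] at hξ
  rw [hξ]

lemma corr_combination (ha : Integrable a) (hf : Integrable f) (hg : Integrable g) (α β : ℝ) :
    ∀ᵐ u : ℝ, corr a (fun v => α * f v + β * g v) u = α * corr a f u + β * corr a g u := by
  filter_upwards [ae_integrable_corr_integrand ha hf, ae_integrable_corr_integrand ha hg]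
    with u h1 h2
  simp only [corr]
  rw [← integral_const_mul, ← integral_const_mul,
    ← integral_add (h1.const_mul α) (h2.const_mul β)]
  congr 1 with ξ
  ring

lemma corr_add (ha : Integrable a) (hf : Integrable f) (hg : Integrable g) :
    ∀ᵐ u : ℝ, corr a (fun v => f v + g v) u = corr a f u + corr a g u := by
  simpa using corr_combination ha hf hg 1 1

/-- The integrated correlation as a Volterra integral operator. -/
lemma integral_corr_indicator (ha : Integrable a) (ha0 : ∀ ξ, 0 < ξ → a ξ = 0) {s t T : ℝ}
    (ht : t ∈ Icc s T) (hg : IntegrableOn g (Icc s T)) :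
    ∫ u in s..t, corr a ((Icc s T).indicator g) u
      = ∫ v in s..t, (∫ ξ in (-(t - v))..0, a ξ) * g v := by
  set f := (Icc s T).indicator g
  have hf : Integrable f := (integrable_indicator_iff measurableSet_Icc).2 hg
  set I : ℝ → ℝ := (Ioc s t).indicator fun _ => (1 : ℝ)
  have hI : Measurable I := measurable_const.indicator measurableSet_Ioc
  have hIb : ∀ v, ‖I v‖ ≤ 1 := fun v => by
    by_cases hv : v ∈ Ioc s t <;> simp [I, hv]
  have int1 : Integrable (Function.uncurry fun u ξ : ℝ => I u * (a ξ * f (u + ξ)))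
      (volume.prod volume) :=
    (integrable_corr_integrand ha hf).bdd_mul (c := 1)
      (hI.comp measurable_fst).aestronglyMeasurable (.of_forall fun p => hIb _)
  have int2 : Integrable (Function.uncurry fun v ξ : ℝ => I (v - ξ) * (a ξ * f v))
      (volume.prod volume) := by
    refine Integrable.bdd_mul (c := 1) ?_
      (hI.comp (measurable_fst.sub measurable_snd)).aestronglyMeasurable
      (.of_forall fun p => hIb _)
    exact (hf.mul_prod ha).congr (.of_forall fun p => mul_comm _ _)
  calc ∫ u in s..t, corr a f u = ∫ u, ∫ ξ, I u * (a ξ * f (u + ξ)) := by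
        rw [intervalIntegral.integral_of_le ht.1, ← integral_indicator measurableSet_Ioc]
        congr 1 with u
        rw [integral_const_mul]
        by_cases hu : u ∈ Ioc s t <;> simp [I, hu, corr]
    _ = ∫ ξ, ∫ u, I u * (a ξ * f (u + ξ)) := integral_integral_swap int1
    _ = ∫ ξ, ∫ v, I (v - ξ) * (a ξ * f v) := by
        congr 1 with ξ
        rw [← integral_add_right_eq_self (fun v => I (v - ξ) * (a ξ * f v)) ξ]
        simp
    _ = ∫ v, ∫ ξ, I (v - ξ) * (a ξ * f v) := (integral_integral_swap int2).symm
    _ = ∫ v in s..t, (∫ ξ in (-(t - v))..0, a ξ) * g v := by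
        rw [intervalIntegral.integral_of_le ht.1, ← integral_indicator measurableSet_Ioc]
        refine integral_congr_ae ?_
        -- The point `v = s` is discarded: it belongs to the closed interval carrying `g` but not to
        -- the half-open one of the time integral.
        filter_upwards [(measure_eq_zero_iff_ae_notMem.1 (measure_singleton (μ := volume) s))]
          with v hv
        simp only [mem_singleton_iff] at hv
        by_cases h1 : v < s
        · have : f v = 0 := indicator_of_notMem (fun h => h1.not_ge h.1) _
          simp [this, h1.le]
        have h1 : s < v := lt_of_le_of_ne (not_lt.1 h1) (Ne.symm hv)
        by_cases h2 : t < v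
        · have e : ∀ ξ, I (v - ξ) * (a ξ * f v) = 0 := by
            intro ξ
            by_cases hξ : 0 < ξ
            · simp [ha0 ξ hξ]
            · have : v - ξ ∉ Ioc s t := fun h => by linarith [h.2]
              simp [I, this]
          simp [e, h2]
        · have h2 : v ≤ t := not_lt.1 h2
          have hfv : f v = g v := indicator_of_mem (show v ∈ Icc s T from ⟨h1.le, h2.trans ht.2⟩) _
          rw [indicator_of_mem (show v ∈ Ioc s t from ⟨h1, h2⟩), hfv,
            intervalIntegral.integral_of_le (by linarith), ← integral_Icc_eq_integral_Ioc,
            ← integral_indicator measurableSet_Icc, ← integral_mul_const]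
          congr 1 with ξ
          by_cases hξ : 0 < ξ
          · simp [ha0 ξ hξ, hξ]
          · by_cases hξ' : -(t - v) ≤ ξ
            · have h3 : v - ξ ∈ Ioc s t := ⟨by linarith, by linarith⟩
              have h4 : ξ ∈ Icc (-(t - v)) 0 := ⟨hξ', not_lt.1 hξ⟩
              rw [indicator_of_mem h4]
              simp [I, h3]
            · have h3 : v - ξ ∉ Ioc s t := fun h => hξ' (by linarith [h.2])
              have h4 : ξ ∉ Icc (-(t - v)) 0 := fun h => hξ' h.1
              rw [indicator_of_notMem h4]
              simp [I, h3]

/-- The kernel `τ ↦ c₀ + ∫_{-τ}^0 c₁` of an element `c = (c₀, c₁)` of the state space. -/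
def kern (c : StateX r) (τ : ℝ) : ℝ := c.fst + ∫ ξ in (-τ)..0, zext c.snd ξ

lemma continuous_kern (c : StateX r) : Continuous (kern c) := by
  have h : Continuous fun x => ∫ ξ in (0 : ℝ)..x, zext c.snd ξ :=
    intervalIntegral.continuous_primitive (fun a b => (integrable_zext _).intervalIntegrable) 0
  have : kern c = fun τ => c.fst - ∫ ξ in (0 : ℝ)..(-τ), zext c.snd ξ := by
    ext τ
    rw [kern, intervalIntegral.integral_symm, sub_eq_add_neg]
  rw [this]
  exact continuous_const.sub (h.comp continuous_neg)

lemma kern_zero (c : StateX r) : kern c 0 = c.fst := by simp [kern]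

/-- The path on the line which follows the history `p` before time `s`, the function `f` on
`[s,T]`, and vanishes elsewhere. -/
def pastPath (T s : ℝ) (p : DelayL2 r) (f : ℝ → ℝ) (τ : ℝ) : ℝ :=
  if τ < s then zext p (τ - s) else (Icc s T).indicator f τ

lemma pastPath_eq_add (T s : ℝ) (p : DelayL2 r) (f : ℝ → ℝ) (τ : ℝ) :
    pastPath T s p f τ = pastPath T s p 0 τ + (Icc s T).indicator f τ := by
  by_cases h : τ < s
  · simp [pastPath, h]
  · simp [pastPath, h]

lemma integrable_pastPath (T s : ℝ) (p : DelayL2 r) {f : ℝ → ℝ} (hf : IntegrableOn f (Icc s T)) :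
    Integrable (pastPath T s p f) := by
  have h1 : Integrable ((Iio s).indicator fun τ => zext p (τ - s)) :=
    ((integrable_zext p).comp_sub_right s).indicator measurableSet_Iio
  refine (h1.add ((integrable_indicator_iff measurableSet_Icc).2 hf)).congr
    (.of_forall fun τ => ?_)
  by_cases h : τ < s
  · simp [pastPath, h]
  · simp [pastPath, h]

lemma pastPath_combination (T s : ℝ) (α β : ℝ) (p q : DelayL2 r) (f g : ℝ → ℝ) :
    pastPath T s (α • p + β • q) (fun v => α * f v + β * g v) =ᵐ[volume]
      fun v => α * pastPath T s p f v + β * pastPath T s q g v := by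
  have := (measurePreserving_sub_right (volume : Measure ℝ) s).quasiMeasurePreserving.ae_eq_comp
    (zext_combination α β p q)
  filter_upwards [this] with v hv
  simp only [Function.comp_apply] at hv
  by_cases h : v < s
  · simp [pastPath, h, hv]
  · by_cases hT : v ∈ Icc s T <;> simp [pastPath, h, hT]

/-- For `u ∈ [s,T]` the window `[u - r, u]` stays within `[s - r, T]`, so cutting the path off
outside that range changes nothing, and the windowed integral becomes a correlation on the whole
line. -/
lemma integral_mul_withHistory (hr : 0 ≤ r) {T s u : ℝ} (hu : u ∈ Icc s T) (a p : DelayL2 r)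
    (f : ℝ → ℝ) :
    ∫ ξ in (-r)..0, a ξ * withHistory s p f (u + ξ) = corr (zext a) (pastPath T s p f) u := by
  rw [intervalIntegral_mul_eq_zext hr a fun ξ => withHistory s p f (u + ξ)]
  unfold corr
  congr 1 with ξ
  by_cases hξ : ξ ∈ Icc (-r) 0
  · congr 1
    by_cases h : u + ξ < s
    · have : u + ξ - s ∈ Icc (-r) 0 := ⟨by linarith [hu.1, hξ.1], by linarith⟩
      simp [withHistory, pastPath, h, zext, this]
    · have : u + ξ ∈ Icc s T := ⟨not_lt.1 h, by linarith [hu.2, hξ.2]⟩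
      simp [withHistory, pastPath, h, this]
  · simp [zext, hξ]

end Delay

/-! ### The delayed drift as a Volterra operator -/

namespace GoodwillModel

variable (M : GoodwillModel) {s : ℝ}

/-- The coefficients `(a₀, a₁)` as an element of the state space. -/
def coeffA : StateX M.r := WithLp.toLp 2 (M.a₀, M.a₁)

/-- The part of the drift which does not depend on the goodwill after time `s`. -/
def forcing (s : ℝ) (x₁ : DelayL2 M.r) (z : ℝ → ℝ) (u : ℝ) : ℝ :=
  corr (zext M.a₁) (pastPath M.T s x₁ 0) u + M.b₀ * z u +
    corr (zext M.b₁) (pastPath M.T s M.δ z) u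

variable {M}

lemma delayDrift_eq (hr : 0 ≤ M.r) {u : ℝ} (hu : u ∈ Icc s M.T) (x₁ : DelayL2 M.r)
    (z y : ℝ → ℝ) :
    M.delayDrift s x₁ z y u = M.a₀ * y u + corr (zext M.a₁) (pastPath M.T s x₁ y) u +
      M.b₀ * z u + corr (zext M.b₁) (pastPath M.T s M.δ z) u := by
  rw [delayDrift, integral_mul_withHistory hr hu, integral_mul_withHistory hr hu]

lemma integrableOn_delayDrift (hr : 0 ≤ M.r) (x₁ : DelayL2 M.r) {z y : ℝ → ℝ}
    (hz : IntegrableOn z (Icc s M.T)) (hy : IntegrableOn y (Icc s M.T)) :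
    IntegrableOn (M.delayDrift s x₁ z y) (Icc s M.T) := by
  have h1 := (integrable_corr (integrable_zext M.a₁)
    (integrable_pastPath M.T s x₁ hy)).integrableOn (s := Icc s M.T)
  have h2 := (integrable_corr (integrable_zext M.b₁)
    (integrable_pastPath M.T s M.δ hz)).integrableOn (s := Icc s M.T)
  refine IntegrableOn.congr_fun ((((hy.const_mul M.a₀).add h1).add (hz.const_mul M.b₀)).add h2)
    (fun u hu => ?_) measurableSet_Icc
  simp [delayDrift_eq hr hu]

lemma delayDrift_combination (hr : 0 ≤ M.r) (x₁ x₂ : DelayL2 M.r) {z₁ z₂ y₁ y₂ : ℝ → ℝ}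
    (hz₁ : IntegrableOn z₁ (Icc s M.T)) (hz₂ : IntegrableOn z₂ (Icc s M.T))
    (hy₁ : IntegrableOn y₁ (Icc s M.T)) (hy₂ : IntegrableOn y₂ (Icc s M.T))
    {α β : ℝ} (hαβ : α + β = 1) :
    ∀ᵐ u : ℝ, u ∈ Icc s M.T →
      M.delayDrift s (α • x₁ + β • x₂) (fun v => α * z₁ v + β * z₂ v)
        (fun v => α * y₁ v + β * y₂ v) u =
      α * M.delayDrift s x₁ z₁ y₁ u + β * M.delayDrift s x₂ z₂ y₂ u := by
  have hδ := pastPath_combination M.T s α β M.δ M.δ z₁ z₂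
  -- Here the weights must add up to one: the combination of the two copies of `δ` is `δ` again.
  rw [← add_smul, hαβ, one_smul] at hδ
  filter_upwards [corr_combination (integrable_zext M.a₁) (integrable_pastPath M.T s x₁ hy₁)
      (integrable_pastPath M.T s x₂ hy₂) α β,
    corr_combination (integrable_zext M.b₁) (integrable_pastPath M.T s M.δ hz₁)
      (integrable_pastPath M.T s M.δ hz₂) α β] with u h1 h2 hu
  rw [delayDrift_eq hr hu, delayDrift_eq hr hu, delayDrift_eq hr hu,
    corr_congr (pastPath_combination M.T s α β x₁ x₂ y₁ y₂) u, corr_congr hδ u, h1, h2]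
  ring

lemma integrableOn_forcing (x₁ : DelayL2 M.r) {z : ℝ → ℝ} (hz : IntegrableOn z (Icc s M.T)) :
    IntegrableOn (M.forcing s x₁ z) (Icc s M.T) :=
  ((integrable_corr (integrable_zext M.a₁) (integrable_pastPath M.T s x₁
    integrableOn_zero)).integrableOn.add (hz.const_mul M.b₀)).add
  (integrable_corr (integrable_zext M.b₁) (integrable_pastPath M.T s M.δ hz)).integrableOn

/-- The integrated drift as a Volterra integral operator acting on the goodwill. -/
lemma integral_delayDrift (hr : 0 ≤ M.r) (x₁ : DelayL2 M.r) {z y : ℝ → ℝ}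
    (hz : IntegrableOn z (Icc s M.T)) (hy : IntegrableOn y (Icc s M.T)) {t : ℝ}
    (ht : t ∈ Icc s M.T) :
    ∫ u in s..t, M.delayDrift s x₁ z y u =
      (∫ u in s..t, M.forcing s x₁ z u) + ∫ u in s..t, kern M.coeffA (t - u) * y u := by
  have sub {f : ℝ → ℝ} (hf : IntegrableOn f (Icc s M.T)) : IntervalIntegrable f volume s t :=
    (intervalIntegrable_iff_integrableOn_Icc_of_le ht.1).2
      (hf.mono_set (Icc_subset_Icc_right ht.2))
  have hi := (integrable_indicator_iff measurableSet_Icc).2 hy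
  have hc : Integrable (corr (zext M.a₁) ((Icc s M.T).indicator y)) :=
    integrable_corr (integrable_zext _) hi
  have h1 : ∫ u in s..t, M.delayDrift s x₁ z y u = ∫ u in s..t,
      (M.forcing s x₁ z u + (M.a₀ * y u + corr (zext M.a₁) ((Icc s M.T).indicator y) u)) := by
    refine intervalIntegral.integral_congr_ae ?_
    filter_upwards [corr_add (integrable_zext M.a₁)
      (integrable_pastPath M.T s x₁ (f := 0) integrableOn_zero) hi] with u h hu
    rw [uIoc_of_le ht.1] at hu
    rw [delayDrift_eq hr ⟨hu.1.le, hu.2.trans ht.2⟩,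
      show pastPath M.T s x₁ y = _ from funext (pastPath_eq_add M.T s x₁ y), h, forcing]
    ring
  have hk : IntervalIntegrable (fun v => (∫ ξ in (-(t - v))..0, zext M.a₁ ξ) * y v) volume s t := by
    refine (sub hy).continuousOn_mul ?_
    have : (fun v => ∫ ξ in (-(t - v))..0, zext M.a₁ ξ) = fun v => kern M.coeffA (t - v) - M.a₀ := by
      ext v; simp [kern, coeffA]
    rw [this]
    exact (((continuous_kern _).comp (by fun_prop)).sub continuous_const).continuousOn
  rw [h1, intervalIntegral.integral_add (sub (integrableOn_forcing x₁ hz))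
    (sub (f := fun u => M.a₀ * y u + _) ((hy.const_mul M.a₀).add hc.integrableOn)),
    intervalIntegral.integral_add (sub (hy.const_mul M.a₀)) hc.intervalIntegrable,
    integral_corr_indicator (integrable_zext _) (fun ξ => zext_of_pos _) ht hy,
    ← intervalIntegral.integral_add (sub (hy.const_mul M.a₀)) hk]
  congr 1
  refine intervalIntegral.integral_congr fun u _ => ?_
  exact (add_mul M.a₀ _ (y u)).symm

end GoodwillModel

/-! ### Transport along characteristics -/

section Transport

open Filter Topology

variable {H : Type*} [NormedAddCommGroup H] [InnerProductSpace ℝ H]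

/-- Integration along characteristics of a transport equation given in weak form: `η` is an orbit
of the (dual) transport semigroup, and `η'` its derivative. -/
lemma inner_eq_of_transport {Z C η η' : ℝ → H} {x : H} {s t c : ℝ} (hst : s ≤ t)
    (hZ : ContinuousOn Z (Icc s t)) (hη : ∀ τ, HasDerivAt η (η' τ) τ) (hη' : Continuous η')
    (hCm : AEStronglyMeasurable C (volume.restrict (Icc s t))) (hCb : ∀ w ∈ Icc s t, ‖C w‖ ≤ c)
    (h : ∀ τ ∈ Icc 0 (t - s), ∀ v ∈ Icc s t, inner ℝ (Z v) (η τ) =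
      inner ℝ x (η τ) + ∫ w in s..v, (inner ℝ (Z w) (η' τ) + inner ℝ (C w) (η τ))) :
    inner ℝ (Z t) (η 0) = inner ℝ x (η (t - s)) + ∫ w in s..t, inner ℝ (C w) (η (t - w)) := by
  have hηc : Continuous η := continuous_iff_continuousAt.2 fun τ => (hη τ).continuousAt
  have hc : 0 ≤ c := (norm_nonneg _).trans (hCb s ⟨le_rfl, hst⟩)
  have hCi {e : ℝ → H} (he : Continuous e) :
      IntegrableOn (fun w => inner ℝ (C w) (e w)) (Icc s t) := by
    obtain ⟨b, hb⟩ := isCompact_Icc.exists_bound_of_continuousOn (he.continuousOn (s := Icc s t))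
    refine Integrable.of_bound (hCm.inner he.aestronglyMeasurable) (c * b) ?_
    filter_upwards [ae_restrict_mem measurableSet_Icc] with w hw
    exact (norm_inner_le_norm _ _).trans
      (mul_le_mul (hCb w hw) (hb w hw) (norm_nonneg _) hc)
  have sub {f : ℝ → ℝ} (hf : IntegrableOn f (Icc s t)) {u v : ℝ} (hu : u ∈ Icc s t)
      (hv : v ∈ Icc s t) : IntervalIntegrable f volume u v := by
    refine (((intervalIntegrable_iff_integrableOn_Icc_of_le hst).2 hf).mono_set ?_)
    rw [uIcc_of_le hst]
    exact uIcc_subset_Icc hu hv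
  have hZi (e : H) : IntegrableOn (fun w => inner ℝ (Z w) e) (Icc s t) :=
    (ContinuousOn.inner (𝕜 := ℝ) hZ continuousOn_const).integrableOn_Icc
  -- The claim is `F t = F s`. Since `Z` need not be differentiable and `C` is only measurable, no
  -- product rule applies; instead the right derivative of the continuous function `F` is shown to
  -- vanish by comparing increments.
  set F : ℝ → ℝ := fun v => inner ℝ (Z v) (η (t - v)) - ∫ w in s..v, inner ℝ (C w) (η (t - w))
  have hCη : IntegrableOn (fun w => inner ℝ (C w) (η (t - w))) (Icc s t) :=
    hCi (hηc.comp (by fun_prop))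
  have hFc : ContinuousOn F (Icc s t) := by
    refine (ContinuousOn.inner (𝕜 := ℝ) hZ (hηc.comp (by fun_prop)).continuousOn).sub ?_
    have := intervalIntegral.continuousOn_primitive_interval (μ := volume)
      (f := fun w => inner ℝ (C w) (η (t - w))) (a := s) (b := t)
      (by rw [uIcc_of_le hst]; exact hCη)
    rwa [uIcc_of_le hst] at this
  have hF : ∀ u ∈ Ico s t, HasDerivWithinAt F 0 (Ici u) u := by
    intro u hu
    have hu' : u ∈ Icc s t := ⟨hu.1, hu.2.le⟩
    rw [hasDerivWithinAt_iff_isLittleO, Asymptotics.isLittleO_iff]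
    intro ε' hε'
    -- Three errors are shared out: variation of the pairing with `η'`, variation of `η` paired with
    -- `C`, and the Taylor remainder of `η`.
    obtain ⟨ε, hε, rfl⟩ : ∃ ε > 0, ε' = 3 * ε := ⟨ε' / 3, by positivity, by ring⟩
    have h1 : ∃ δ > 0, ∀ v ∈ Icc u (min t (u + δ)), ∀ w ∈ Icc u v,
        |inner ℝ (Z w) (η' (t - v)) - inner ℝ (Z u) (η' (t - u))| ≤ ε := by
      have hcont : ContinuousWithinAt (fun p : ℝ × ℝ => inner ℝ (Z p.1) (η' (t - p.2)))
          (Icc s t ×ˢ univ) (u, u) := by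
        have hz : ContinuousWithinAt (fun p : ℝ × ℝ => Z p.1) (Icc s t ×ˢ univ) (u, u) :=
          (hZ u hu').comp (t := Icc s t) continuous_fst.continuousWithinAt fun p hp => hp.1
        exact ContinuousWithinAt.inner (𝕜 := ℝ) hz (hη'.comp (by fun_prop)).continuousWithinAt
      obtain ⟨δ, hδ, h⟩ := Metric.continuousWithinAt_iff.1 hcont ε hε
      refine ⟨δ / 2, by positivity, fun v hv w hw => ?_⟩
      have hv2 := hv.2
      rw [le_min_iff] at hv2
      have := h (x := (w, v)) ⟨⟨hu.1.trans hw.1, hw.2.trans hv2.1⟩, mem_univ _⟩ (by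
        rw [Prod.dist_eq, max_lt_iff, Real.dist_eq, Real.dist_eq, abs_of_nonneg (by linarith [hw.1]),
          abs_of_nonneg (by linarith [hv.1])]
        exact ⟨by linarith [hw.2, hv2.2], by linarith [hv2.2]⟩)
      exact this.le
    have h2 : ∃ δ > 0, ∀ v ∈ Icc u (u + δ), ∀ w ∈ Icc u v,
        c * ‖η (t - v) - η (t - w)‖ ≤ ε := by
      have hcont : ContinuousAt (fun p : ℝ × ℝ => c * ‖η (t - p.2) - η (t - p.1)‖) (u, u) :=
        Continuous.continuousAt (by fun_prop)
      obtain ⟨δ, hδ, h⟩ := Metric.continuousAt_iff.1 hcont ε hε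
      refine ⟨δ / 2, by positivity, fun v hv w hw => ?_⟩
      have := h (x := (w, v)) (by
        rw [Prod.dist_eq, max_lt_iff, Real.dist_eq, Real.dist_eq, abs_of_nonneg (by linarith [hw.1]),
          abs_of_nonneg (by linarith [hv.1])]
        exact ⟨by linarith [hw.2, hv.2], by linarith [hv.2]⟩)
      simp only [sub_self, norm_zero, mul_zero, dist_zero_right] at this
      exact (le_abs_self _).trans this.le
    obtain ⟨δ₁, hδ₁, h1⟩ := h1
    obtain ⟨δ₂, hδ₂, h2⟩ := h2
    have h3 : ∀ᶠ v in 𝓝[Ici u] u, ‖inner ℝ (Z u) (η (t - v)) - inner ℝ (Z u) (η (t - u)) +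
        (v - u) * inner ℝ (Z u) (η' (t - u))‖ ≤ ε * ‖v - u‖ := by
      have hd : HasDerivAt (fun v => inner ℝ (Z u) (η (t - v))) (-inner ℝ (Z u) (η' (t - u))) u := by
        have h0 : HasDerivAt (fun v : ℝ => t - v) (-1) u := by
          simpa using (hasDerivAt_id u).const_sub t
        have h1 := (hη (t - u)).scomp u h0
        have h2 := (hasDerivAt_const u (Z u)).inner ℝ h1
        simpa using h2
      have := (hasDerivAt_iff_isLittleO.1 hd).def hε
      refine (this.filter_mono nhdsWithin_le_nhds).mono fun v hv => ?_
      simpa [sub_eq_add_neg, smul_eq_mul] using hv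
    have h4 : ∀ᶠ v in 𝓝[Ici u] u, v ∈ Icc u (min t (u + min δ₁ δ₂)) :=
      Icc_mem_nhdsGE (lt_min hu.2 (by simp [hδ₁, hδ₂]))
    filter_upwards [h3, h4] with v hv3 hv4
    have hvt : v ≤ t := hv4.2.trans (min_le_left _ _)
    have hvδ : v ≤ u + min δ₁ δ₂ := hv4.2.trans (min_le_right _ _)
    have hvδ₁ : v ≤ u + δ₁ := hvδ.trans (by gcongr; exact min_le_left _ _)
    have hvδ₂ : v ≤ u + δ₂ := hvδ.trans (by gcongr; exact min_le_right _ _)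
    have huv : u ≤ v := hv4.1
    have hv' : v ∈ Icc s t := ⟨hu.1.trans huv, hvt⟩
    have hs' : s ∈ Icc s t := ⟨le_rfl, hst⟩
    have hτ : t - v ∈ Icc 0 (t - s) := ⟨by linarith, by linarith [hv'.1]⟩
    have hint : IntegrableOn
        (fun w => inner ℝ (Z w) (η' (t - v)) + inner ℝ (C w) (η (t - v))) (Icc s t) :=
      (hZi _).add (hCi continuous_const)
    -- The weak equation is used at the times `u` and `v` with the same test element `η (t - v)`,
    -- frozen at the right end.
    have e1 : inner ℝ (Z v) (η (t - v)) - inner ℝ (Z u) (η (t - v)) =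
        ∫ w in u..v, (inner ℝ (Z w) (η' (t - v)) + inner ℝ (C w) (η (t - v))) := by
      rw [h _ hτ v hv', h _ hτ u hu', add_sub_add_left_eq_sub,
        intervalIntegral.integral_interval_sub_left (sub hint hs' hv') (sub hint hs' hu')]
    have e2 : F v - F u = (∫ w in u..v, (inner ℝ (Z w) (η' (t - v)) - inner ℝ (Z u) (η' (t - u))
          + inner ℝ (C w) (η (t - v) - η (t - w)))) +
        (inner ℝ (Z u) (η (t - v)) - inner ℝ (Z u) (η (t - u)) +
          (v - u) * inner ℝ (Z u) (η' (t - u))) := by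
      have e3 : (∫ w in s..v, inner ℝ (C w) (η (t - w))) - ∫ w in s..u, inner ℝ (C w) (η (t - w))
          = ∫ w in u..v, inner ℝ (C w) (η (t - w)) :=
        intervalIntegral.integral_interval_sub_left (sub hCη hs' hv') (sub hCη hs' hu')
      have e4 : (∫ w in u..v, (inner ℝ (Z w) (η' (t - v)) - inner ℝ (Z u) (η' (t - u))
          + inner ℝ (C w) (η (t - v) - η (t - w)))) =
          (∫ w in u..v, (inner ℝ (Z w) (η' (t - v)) + inner ℝ (C w) (η (t - v))))
          - (∫ w in u..v, inner ℝ (C w) (η (t - w))) - (v - u) * inner ℝ (Z u) (η' (t - u)) := by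
        have : (v - u) * inner ℝ (Z u) (η' (t - u)) = ∫ w in u..v, inner ℝ (Z u) (η' (t - u)) := by
          simp
        rw [this, ← intervalIntegral.integral_sub (sub hint hu' hv') (sub hCη hu' hv'),
          ← intervalIntegral.integral_sub ((sub hint hu' hv').sub (sub hCη hu' hv'))
            intervalIntegrable_const]
        refine intervalIntegral.integral_congr fun w _ => ?_
        simp only [inner_sub_right]
        ring
      simp only [F]
      rw [e4, ← e1, ← e3]
      ring
    have b1 : ‖∫ w in u..v, (inner ℝ (Z w) (η' (t - v)) - inner ℝ (Z u) (η' (t - u))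
          + inner ℝ (C w) (η (t - v) - η (t - w)))‖ ≤ (2 * ε) * |v - u| := by
      refine intervalIntegral.norm_integral_le_of_norm_le_const fun w hw => ?_
      rw [uIoc_of_le huv] at hw
      have hw1 : w ∈ Icc u v := ⟨hw.1.le, hw.2⟩
      refine (norm_add_le _ _).trans ?_
      have := h1 v ⟨huv, le_min hvt hvδ₁⟩ w hw1
      have h6 := h2 v ⟨huv, hvδ₂⟩ w hw1
      have h7 : ‖inner ℝ (C w) (η (t - v) - η (t - w))‖ ≤ c * ‖η (t - v) - η (t - w)‖ :=
        (norm_inner_le_norm _ _).trans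
          (by gcongr; exact hCb w ⟨hu.1.trans hw1.1, hw1.2.trans hvt⟩)
      rw [Real.norm_eq_abs]
      linarith
    rw [smul_zero, sub_zero, e2]
    refine (norm_add_le _ _).trans ?_
    rw [← Real.norm_eq_abs] at b1
    linarith
  have := constant_of_has_deriv_right_zero hFc hF t ⟨hst, le_rfl⟩
  simp only [F, sub_self, intervalIntegral.integral_same, sub_zero] at this
  have h0 := h (t - s) ⟨by linarith, le_rfl⟩ s ⟨le_rfl, hst⟩
  simp only [intervalIntegral.integral_same, add_zero] at h0
  linarith

end Transport

/-! ### Smooth elements of the state space -/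

section StateOf

open Filter Topology

variable {r : ℝ}

lemma memLp_continuousMap (f : C(ℝ, ℝ)) : MemLp f 2 (volume.restrict (Icc (-r) 0)) := by
  obtain ⟨b, hb⟩ := isCompact_Icc.exists_bound_of_continuousOn
    (f.continuous.continuousOn (s := Icc (-r) 0))
  refine MemLp.of_bound f.continuous.aestronglyMeasurable b ?_
  filter_upwards [ae_restrict_mem measurableSet_Icc] with ξ hξ using hb ξ hξ

/-- The class in `L²([-r,0])` of a continuous function. -/
def lpOf (r : ℝ) (f : C(ℝ, ℝ)) : DelayL2 r := (memLp_continuousMap f).toLp f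

/-- The element `(f(0), f|[-r,0])` of the state space. -/
def stateOf (r : ℝ) (f : C(ℝ, ℝ)) : StateX r := WithLp.toLp 2 (f 0, lpOf r f)

lemma coeFn_lpOf (f : C(ℝ, ℝ)) : lpOf r f =ᵐ[volume.restrict (Icc (-r) 0)] f :=
  MemLp.coeFn_toLp _

lemma stateOf_sub (f g : C(ℝ, ℝ)) : stateOf r (f - g) = stateOf r f - stateOf r g := rfl

lemma stateOf_smul (c : ℝ) (f : C(ℝ, ℝ)) : stateOf r (c • f) = c • stateOf r f := rfl

lemma inner_lp (a b : DelayL2 r) :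
    inner ℝ a b = ∫ ξ, zext a ξ * b ξ := by
  rw [L2.inner_def, ← integral_indicator measurableSet_Icc]
  congr 1 with ξ
  by_cases h : ξ ∈ Icc (-r) 0 <;> simp [zext, h, mul_comm]

lemma inner_lpOf (a : DelayL2 r) (f : C(ℝ, ℝ)) :
    inner ℝ a (lpOf r f) = ∫ ξ, zext a ξ * f ξ := by
  rw [inner_lp]
  refine integral_congr_ae ?_
  filter_upwards [(ae_restrict_iff' measurableSet_Icc).1 (coeFn_lpOf (r := r) f)] with ξ hξ
  by_cases h : ξ ∈ Icc (-r) 0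
  · rw [hξ h]
  · simp [zext, h]

lemma inner_state (x y : StateX r) : inner ℝ x y = x.fst * y.fst + inner ℝ x.snd y.snd := by
  rw [WithLp.prod_inner_apply]
  simp [mul_comm]

lemma inner_stateOf (x : StateX r) (f : C(ℝ, ℝ)) :
    inner ℝ x (stateOf r f) = x.fst * f 0 + ∫ ξ, zext x.snd ξ * f ξ := by
  rw [inner_state, ← inner_lpOf]
  rfl

lemma norm_state_le (x : StateX r) : ‖x‖ ≤ ‖x.fst‖ + ‖x.snd‖ := by
  rw [WithLp.prod_norm_eq_of_L2]
  refine Real.sqrt_le_iff.2 ⟨by positivity, ?_⟩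
  nlinarith [norm_nonneg x.fst, norm_nonneg x.snd]

/-- Transfers uniform estimates on `[-r,0]` to the state space, so that continuity and
differentiability of translates reduce to Lipschitz and Taylor bounds for real functions. -/
lemma exists_norm_stateOf_le (hr : 0 ≤ r) : ∃ K : ℝ≥0, ∀ (f : C(ℝ, ℝ)) (c : ℝ),
    (∀ ξ ∈ Icc (-r) 0, |f ξ| ≤ c) → ‖stateOf r f‖ ≤ K * c := by
  refine ⟨1 + measureUnivNNReal (volume.restrict (Icc (-r) 0)) ^ (2 : ℝ)⁻¹, fun f c hc => ?_⟩
  have h0 : |f 0| ≤ c := hc 0 ⟨by linarith, le_rfl⟩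
  have hc0 : 0 ≤ c := (abs_nonneg _).trans h0
  have h1 := Lp.norm_le_of_ae_bound (f := lpOf r f) hc0 (by
    filter_upwards [coeFn_lpOf (r := r) f, ae_restrict_mem measurableSet_Icc] with ξ h1 h2
    rw [h1]; exact hc ξ h2)
  rw [ENNReal.toReal_ofNat] at h1
  calc ‖stateOf r f‖ ≤ |f 0| + ‖lpOf r f‖ := norm_state_le _
    _ ≤ c + _ := add_le_add h0 h1
    _ = _ := by push_cast; ring

/-- The translate `ξ ↦ f (ξ + τ)`. -/
def shiftBy (f : C(ℝ, ℝ)) (τ : ℝ) : C(ℝ, ℝ) := ⟨fun ξ => f (ξ + τ), by fun_prop⟩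

lemma continuous_stateOf_shiftBy (hr : 0 ≤ r) {f : C(ℝ, ℝ)} {C : ℝ≥0} (hf : LipschitzWith C f) :
    Continuous fun τ => stateOf r (shiftBy f τ) := by
  obtain ⟨K, hK⟩ := exists_norm_stateOf_le hr
  have : LipschitzWith (K * C) fun τ => stateOf r (shiftBy f τ) := by
    refine LipschitzWith.of_dist_le_mul fun τ τ' => ?_
    rw [dist_eq_norm, ← stateOf_sub]
    refine (hK _ (C * dist τ τ') fun ξ _ => ?_).trans_eq ?_
    · have := hf.dist_le_mul (ξ + τ) (ξ + τ')
      rw [dist_add_left] at this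
      exact this
    · push_cast; ring
  exact this.continuous

lemma abs_sub_sub_le_of_lipschitz {f f' : ℝ → ℝ} {C : ℝ≥0} (hf : ∀ x, HasDerivAt f (f' x) x)
    (hf' : LipschitzWith C f') (a b : ℝ) : |f b - f a - (b - a) * f' a| ≤ C * |b - a| ^ 2 := by
  have h := Convex.norm_image_sub_le_of_norm_hasDerivWithin_le (f := fun x => f x - x * f' a)
    (f' := fun x => f' x - f' a) (C := C * |b - a|) (s := uIcc a b) (x := a) (y := b)
    (fun x _ => by
      have := (hf x).sub ((hasDerivAt_id x).mul_const (f' a))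
      rw [one_mul] at this
      exact this.hasDerivWithinAt)
    (fun x hx => by
      refine (hf'.dist_le_mul x a).trans ?_
      gcongr
      rw [Real.dist_eq]
      exact abs_sub_left_of_mem_uIcc hx)
    (convex_uIcc a b) left_mem_uIcc right_mem_uIcc
  calc |f b - f a - (b - a) * f' a| = ‖f b - b * f' a - (f a - a * f' a)‖ := by
        rw [Real.norm_eq_abs]; congr 1; ring
    _ ≤ _ := h
    _ = _ := by rw [Real.norm_eq_abs]; ring

lemma hasDerivAt_stateOf_shiftBy (hr : 0 ≤ r) {f f' : C(ℝ, ℝ)} {C : ℝ≥0}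
    (hf : ∀ x, HasDerivAt f (f' x) x) (hf' : LipschitzWith C f') (τ : ℝ) :
    HasDerivAt (fun τ => stateOf r (shiftBy f τ)) (stateOf r (shiftBy f' τ)) τ := by
  obtain ⟨K, hK⟩ := exists_norm_stateOf_le hr
  rw [hasDerivAt_iff_isLittleO]
  have hO : (fun x' => stateOf r (shiftBy f x') - stateOf r (shiftBy f τ) -
      (x' - τ) • stateOf r (shiftBy f' τ)) =O[𝓝 τ] fun x' => ‖x' - τ‖ ^ 2 := by
    refine Asymptotics.IsBigO.of_bound (K * C) (.of_forall fun x' => ?_)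
    rw [← stateOf_sub, ← stateOf_smul, ← stateOf_sub]
    refine (hK _ (C * |x' - τ| ^ 2) fun ξ _ => ?_).trans_eq ?_
    · have := abs_sub_sub_le_of_lipschitz hf hf' (ξ + τ) (ξ + x')
      rw [add_sub_add_left_eq_sub] at this
      exact this
    · simp; ring
  refine hO.trans_isLittleO ?_
  have h := (Asymptotics.isLittleO_pow_id (𝕜 := ℝ) one_lt_two).comp_tendsto
    (tendsto_sub_nhds_zero_iff.2 (tendsto_id (x := 𝓝 τ)))
  simpa [Function.comp_def] using h

/-- Integration by parts against a Sobolev function vanishing at `-r`. -/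
lemma inner_lpOf_deriv (hr : 0 ≤ r) {f f' : C(ℝ, ℝ)} (hf : ∀ x, HasDerivAt f (f' x) x)
    {a g : DelayL2 r} {w : ℝ → ℝ} (hw : IsSobolevRep a w g) (hw0 : w (-r) = 0) :
    inner ℝ a (lpOf r f') = w 0 * f 0 - inner ℝ g (lpOf r f) := by
  have hg : IntervalIntegrable g volume (-r) 0 := by
    rw [intervalIntegrable_iff_integrableOn_Icc_of_le (by linarith)]
    exact (Lp.memLp g).integrable (by norm_num : (1 : ℝ≥0∞) ≤ 2)
  have hwe : ∀ ξ ∈ Icc (-r) 0, w ξ = ∫ ζ in (-r)..ξ, g ζ := fun ξ hξ => by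
    rw [hw.2 ξ hξ, hw0, zero_add]
  have hac := hg.absolutelyContinuousOnInterval_intervalIntegral left_mem_uIcc
  have hfd : deriv f = f' := funext fun x => (hf x).deriv
  have hfac : AbsolutelyContinuousOnInterval f (-r) 0 := by
    refine ContDiffOn.absolutelyContinuousOnInterval (ContDiff.contDiffOn ?_)
    exact contDiff_one_iff_deriv.2 ⟨fun x => (hf x).differentiableAt, hfd ▸ f'.continuous⟩
  have hp := hac.integral_mul_deriv_eq_deriv_mul hfac
  have e1 : inner ℝ a (lpOf r f') = ∫ ξ in (-r)..0, (∫ ζ in (-r)..ξ, g ζ) * deriv f ξ := by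
    rw [L2.inner_def, intervalIntegral.integral_of_le (by linarith), ← integral_Icc_eq_integral_Ioc]
    refine integral_congr_ae ?_
    filter_upwards [hw.1, coeFn_lpOf (r := r) f', ae_restrict_mem measurableSet_Icc] with ξ h1 h2 h3
    rw [h1, h2, hwe ξ h3, hfd]
    simp [mul_comm]
  have e2 : inner ℝ g (lpOf r f) = ∫ ξ in (-r)..0, deriv (fun x => ∫ ζ in (-r)..x, g ζ) ξ * f ξ := by
    rw [L2.inner_def, intervalIntegral.integral_of_le (by linarith), ← integral_Icc_eq_integral_Ioc]
    refine integral_congr_ae ?_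
    filter_upwards [ae_restrict_of_ae hg.ae_hasDerivAt_integral, coeFn_lpOf (r := r) f,
      ae_restrict_mem measurableSet_Icc] with ξ h1 h2 h3
    have h4 : ξ ∈ uIcc (-r) 0 := by rwa [uIcc_of_le (by linarith)]
    rw [(h1 h4 (-r) left_mem_uIcc).deriv, h2]
    simp [mul_comm]
  rw [e1, hp, e2, hwe 0 ⟨by linarith, le_rfl⟩]
  simp

end StateOf

/-! ### The first component of a weak solution -/

section Cutoff

open Filter Topology

variable {r : ℝ}

/-- A smooth approximation of the indicator function of `[0,∞)`. -/
def cutoff (n : ℕ) : C(ℝ, ℝ) :=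
  ⟨fun x => Real.smoothTransition (1 + n * x),
    Real.smoothTransition.continuous.comp (by fun_prop)⟩

lemma contDiff_deriv_smoothTransition : ContDiff ℝ 1 (deriv Real.smoothTransition) := by
  have h : ContDiff ℝ ((1 : ℕ∞) + 1 : ℕ∞) Real.smoothTransition := Real.smoothTransition.contDiff
  exact (contDiff_succ_iff_deriv (n := 1).1 (by exact_mod_cast h)).2.2

lemma deriv_smoothTransition_of_one_le {x : ℝ} (hx : 1 ≤ x) :
    deriv Real.smoothTransition x = 0 := by
  have hmax : IsLocalMax Real.smoothTransition x := .of_forall fun y => by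
    rw [Real.smoothTransition.one_of_one_le hx]
    exact Real.smoothTransition.le_one y
  exact hmax.deriv_eq_zero

lemma deriv_smoothTransition_of_nonpos {x : ℝ} (hx : x ≤ 0) :
    deriv Real.smoothTransition x = 0 := by
  have hmin : IsLocalMin Real.smoothTransition x := .of_forall fun y => by
    rw [Real.smoothTransition.zero_of_nonpos hx]
    exact Real.smoothTransition.nonneg y
  exact hmin.deriv_eq_zero

/-- The derivative of `cutoff n`. -/
def cutoffDeriv (n : ℕ) : C(ℝ, ℝ) :=
  ⟨fun x => n * deriv Real.smoothTransition (1 + n * x),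
    continuous_const.mul (contDiff_deriv_smoothTransition.continuous.comp (by fun_prop))⟩

lemma hasDerivAt_cutoff (n : ℕ) (x : ℝ) : HasDerivAt (cutoff n) (cutoffDeriv n x) x := by
  have h1 : HasDerivAt (fun x : ℝ => 1 + n * x) n x := by
    simpa using ((hasDerivAt_id x).const_mul (n : ℝ)).const_add 1
  have h2 : HasDerivAt Real.smoothTransition (deriv Real.smoothTransition (1 + n * x))
      (1 + n * x) :=
    ((Real.smoothTransition.contDiff (n := 1)).differentiable (by simp) _).hasDerivAt
  have := h2.comp x h1
  rw [mul_comm] at this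
  exact this

lemma exists_lipschitzWith_cutoffDeriv (n : ℕ) : ∃ C, LipschitzWith C (cutoffDeriv n) := by
  have hs : HasCompactSupport (deriv Real.smoothTransition) := by
    refine HasCompactSupport.intro (isCompact_Icc (a := 0) (b := 1)) fun x hx => ?_
    by_cases h : x ≤ 0
    · exact deriv_smoothTransition_of_nonpos h
    · refine deriv_smoothTransition_of_one_le (not_lt.1 fun h1 => hx ⟨(not_le.1 h).le, h1.le⟩)
  obtain ⟨C, hC⟩ := contDiff_deriv_smoothTransition.lipschitzWith_of_hasCompactSupport hs (by simp)
  refine ⟨n * (C * n), LipschitzWith.of_dist_le_mul fun x y => ?_⟩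
  change dist ((n : ℝ) * deriv Real.smoothTransition (1 + n * x))
    (n * deriv Real.smoothTransition (1 + n * y)) ≤ _
  have h := hC.dist_le_mul (1 + n * x) (1 + n * y)
  rw [dist_add_left] at h
  rw [Real.dist_eq, ← mul_sub, abs_mul, Nat.abs_cast, ← Real.dist_eq]
  rw [Real.dist_eq (n * x), ← mul_sub, abs_mul, Nat.abs_cast, ← Real.dist_eq] at h
  push_cast
  rw [mul_assoc (n : ℝ), mul_assoc (C : ℝ)]
  gcongr

lemma cutoff_of_nonneg (n : ℕ) {x : ℝ} (hx : 0 ≤ x) : cutoff n x = 1 :=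
  Real.smoothTransition.one_of_one_le (by have : 0 ≤ n * x := by positivity
                                          linarith)

lemma cutoffDeriv_of_nonneg (n : ℕ) {x : ℝ} (hx : 0 ≤ x) : cutoffDeriv n x = 0 := by
  have : (1 : ℝ) ≤ 1 + n * x := by have : 0 ≤ n * x := by positivity
                                   linarith
  change (n : ℝ) * deriv Real.smoothTransition (1 + n * x) = 0
  rw [deriv_smoothTransition_of_one_le this, mul_zero]

lemma abs_cutoff_le (n : ℕ) (x : ℝ) : |cutoff n x| ≤ 1 :=
  abs_le.2 ⟨by linarith [Real.smoothTransition.nonneg (1 + n * x),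
    show cutoff n x = Real.smoothTransition (1 + n * x) from rfl],
    Real.smoothTransition.le_one _⟩

lemma tendsto_cutoff_of_neg {x : ℝ} (hx : x < 0) :
    Tendsto (fun n => cutoff n x) atTop (𝓝 0) := by
  refine tendsto_const_nhds.congr' ?_
  obtain ⟨N, hN⟩ := exists_nat_ge (-x)⁻¹
  filter_upwards [eventually_ge_atTop N] with n hn
  refine (Real.smoothTransition.zero_of_nonpos ?_).symm
  have h1 : (-x)⁻¹ ≤ n := hN.trans (by exact_mod_cast hn)
  have h2 : (-x)⁻¹ * (-x) ≤ n * (-x) := mul_le_mul_of_nonneg_right h1 (by linarith)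
  rw [inv_mul_cancel₀ (by linarith)] at h2
  linarith

lemma abs_inner_cutoff_le (c : StateX r) (n : ℕ) (τ : ℝ) :
    |inner ℝ c (stateOf r (shiftBy (cutoff n) τ))| ≤ |c.fst| + ∫ ξ, |zext c.snd ξ| := by
  rw [inner_stateOf]
  refine (abs_add_le _ _).trans (add_le_add ?_ ?_)
  · rw [abs_mul]
    exact mul_le_of_le_one_right (abs_nonneg _) (abs_cutoff_le n _)
  · have h : ‖∫ ξ, zext c.snd ξ * shiftBy (cutoff n) τ ξ‖ ≤ ∫ ξ, |zext c.snd ξ| := by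
      refine norm_integral_le_of_norm_le (integrable_zext _).abs (.of_forall fun ξ => ?_)
      rw [norm_mul]
      exact mul_le_of_le_one_right (abs_nonneg _) (abs_cutoff_le n _)
    exact h

/-- The translated cutoffs converge pointwise to the indicator of `[-τ,∞)`, so the test elements
approach `(1, 1_{[-τ,0]})`. This limit is the dual orbit of `(1, 0)`, generally outside `D(A*)`,
hence the smoothing. -/
lemma tendsto_inner_cutoff (c : StateX r) {τ : ℝ} (hτ : 0 ≤ τ) :
    Tendsto (fun n => inner ℝ c (stateOf r (shiftBy (cutoff n) τ))) atTop (𝓝 (kern c τ)) := by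
  have h1 : ∀ n, inner ℝ c (stateOf r (shiftBy (cutoff n) τ)) =
      c.fst + ∫ ξ, zext c.snd ξ * cutoff n (ξ + τ) := fun n => by
    rw [inner_stateOf]
    change c.fst * cutoff n (0 + τ) + _ = _
    rw [zero_add, cutoff_of_nonneg n hτ, mul_one]
    rfl
  simp only [h1, kern]
  refine tendsto_const_nhds.add ?_
  have h2 : ∫ ξ in (-τ)..0, zext c.snd ξ = ∫ ξ, (Ici (-τ)).indicator (zext c.snd) ξ := by
    rw [intervalIntegral.integral_of_le (by linarith), ← integral_Icc_eq_integral_Ioc,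
      ← integral_indicator measurableSet_Icc]
    congr 1 with ξ
    by_cases h : 0 < ξ
    · simp [indicator, zext_of_pos _ h]
    · simp [indicator, not_lt.1 h]
  rw [h2]
  refine tendsto_integral_of_dominated_convergence (fun ξ => |zext c.snd ξ|) (fun n => ?_)
    (integrable_zext _).abs (fun n => .of_forall fun ξ => ?_) (.of_forall fun ξ => ?_)
  · exact (measurable_zext _).aestronglyMeasurable.mul
      ((cutoff n).continuous.comp (by fun_prop)).aestronglyMeasurable
  · rw [norm_mul]
    exact mul_le_of_le_one_right (abs_nonneg _) (abs_cutoff_le n _)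
  · by_cases h : -τ ≤ ξ
    · rw [indicator_of_mem (show ξ ∈ Ici (-τ) from h)]
      refine tendsto_const_nhds.congr fun n => ?_
      rw [cutoff_of_nonneg n (by linarith), mul_one]
    · rw [indicator_of_notMem (show ξ ∉ Ici (-τ) from h)]
      have := (tendsto_cutoff_of_neg (x := ξ + τ) (by linarith)).const_mul (zext c.snd ξ)
      rwa [mul_zero] at this

end Cutoff

/-! ### The scalar equation hidden in the weak formulation -/

namespace GoodwillModel

open Filter Topology

variable {M : GoodwillModel}

variable (M) in
/-- The coefficients `(b₀, b₁)` as an element of the state space. -/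
def coeffB : StateX M.r := WithLp.toLp 2 (M.b₀, M.b₁)

lemma B_eq_smul (u : ℝ) : M.B u = u • M.coeffB := by
  rw [B, coeffB, ← WithLp.toLp_smul, Prod.smul_mk, smul_eq_mul, mul_comm]

/-- Smooth elements of the domain of the adjoint operator. -/
lemma isGenAdjoint_stateOf (hr : 0 ≤ M.r) {f f' : C(ℝ, ℝ)} (hf : ∀ x, HasDerivAt f (f' x) x) :
    M.IsGenAdjoint (stateOf M.r f)
      (WithLp.toLp 2 (inner ℝ M.coeffA (stateOf M.r f), lpOf M.r f')) := by
  rintro x v ⟨w, g, hw, hw0, h1, h2⟩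
  -- The first component of `stateOf` is `f 0`, so the boundary term at `0` from integration by
  -- parts cancels the contribution of `x₁(0)`; at `-r` the boundary condition removes it.
  rw [inner_state, inner_state, inner_state, h1, h2, inner_sub_left, real_inner_smul_left]
  change (M.a₀ * x.fst + w 0) * f 0 + (x.fst * inner ℝ M.a₁ (lpOf M.r f) - inner ℝ g (lpOf M.r f))
    = x.fst * (M.a₀ * f 0 + inner ℝ M.a₁ (lpOf M.r f)) + inner ℝ x.snd (lpOf M.r f')
  rw [inner_lpOf_deriv hr hf hw hw0]
  ring

/-- The first component of a weak solution solves a scalar Volterra equation. -/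
lemma weak_fst_eq (hr : 0 ≤ M.r) {s t c : ℝ} (hst : s ≤ t) {x : StateX M.r} {Y : ℝ → StateX M.r}
    {z w : ℝ → ℝ} (hY : ContinuousOn Y (Icc s t)) (hw : ContinuousOn w (Icc s t))
    (hz : AEStronglyMeasurable z (volume.restrict (Icc s t))) (hzb : ∀ u ∈ Icc s t, |z u| ≤ c)
    (heq : ∀ η ζ : StateX M.r, M.IsGenAdjoint η ζ → ∀ v ∈ Icc s t,
      inner ℝ (Y v) η = inner ℝ x η +
        (∫ u in s..v, (inner ℝ (Y u) ζ + inner ℝ (M.B (z u)) η)) + inner ℝ (M.G (w v)) η) :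
    (Y t).fst = kern x (t - s) +
      (∫ u in s..t, ((Y u).fst * kern M.coeffA (t - u) + z u * kern M.coeffB (t - u))) +
      M.σ * w t := by
  have hG : Continuous M.G := by
    unfold G
    exact (WithLp.prod_continuous_toLp 2 ℝ (DelayL2 M.r)).comp (by fun_prop)
  have hfst : ContinuousOn (fun u => (Y u).fst) (Icc s t) :=
    (continuous_fst.comp (WithLp.prod_continuous_ofLp 2 ℝ (DelayL2 M.r))).comp_continuousOn hY
  obtain ⟨b, hb⟩ := isCompact_Icc.exists_bound_of_continuousOn hfst
  -- Subtracting the noise leaves an equation without noise. The control and the rank-one term `(Y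
  -- u).fst • M.coeffA` of the generator form the forcing `C`, so that only pure translation acts on
  -- the test elements.
  set Z : ℝ → StateX M.r := fun v => Y v - M.G (w v)
  set C : ℝ → StateX M.r := fun u => (Y u).fst • M.coeffA + z u • M.coeffB
  have hZ : ContinuousOn Z (Icc s t) := hY.sub (hG.comp_continuousOn hw)
  have hCm : AEStronglyMeasurable C (volume.restrict (Icc s t)) :=
    ((hfst.aestronglyMeasurable measurableSet_Icc).smul_const _).add (hz.smul_const _)
  have hCb : ∀ u ∈ Icc s t, ‖C u‖ ≤ b * ‖M.coeffA‖ + c * ‖M.coeffB‖ := fun u hu => by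
    refine (norm_add_le _ _).trans ?_
    rw [norm_smul, norm_smul]
    have h1 := hb u hu
    have h2 : ‖z u‖ ≤ c := hzb u hu
    gcongr
  have key : ∀ n : ℕ, inner ℝ (Z t) (stateOf M.r (shiftBy (cutoff n) 0)) =
      inner ℝ x (stateOf M.r (shiftBy (cutoff n) (t - s))) +
        ∫ u in s..t, inner ℝ (C u) (stateOf M.r (shiftBy (cutoff n) (t - u))) := by
    intro n
    obtain ⟨L, hL⟩ := exists_lipschitzWith_cutoffDeriv n
    refine inner_eq_of_transport hst hZ
      (hasDerivAt_stateOf_shiftBy hr (hasDerivAt_cutoff n) hL)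
      (continuous_stateOf_shiftBy hr hL) hCm hCb fun τ hτ v hv => ?_
    have hd : ∀ ξ, HasDerivAt (shiftBy (cutoff n) τ) (shiftBy (cutoffDeriv n) τ ξ) ξ := fun ξ =>
      (hasDerivAt_cutoff n (ξ + τ)).comp_add_const ξ τ
    -- The cutoff is constant on `[0,∞)`, so for `τ ≥ 0` the derivative of the orbit has zero first
    -- component. This matches the transport part of `A*`, and it makes the pairing of the noise `(σ
    -- w, 0)` with this derivative vanish.
    have hd0 : shiftBy (cutoffDeriv n) τ 0 = 0 := cutoffDeriv_of_nonneg n (by simpa using hτ.1)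
    have h := heq _ _ (isGenAdjoint_stateOf hr hd) v hv
    rw [inner_sub_left, h, add_sub_cancel_right]
    congr 1
    refine intervalIntegral.integral_congr fun u _ => ?_
    simp only [Z, C]
    rw [inner_sub_left, inner_add_left, real_inner_smul_left, real_inner_smul_left, B_eq_smul,
      real_inner_smul_left, inner_state (Y u), inner_state (Y u), inner_state (M.G _)]
    change (Y u).fst * inner ℝ M.coeffA _ + inner ℝ (Y u).snd (lpOf M.r (shiftBy (cutoffDeriv n) τ))
        + _ = (Y u).fst * shiftBy (cutoffDeriv n) τ 0
        + inner ℝ (Y u).snd (lpOf M.r (shiftBy (cutoffDeriv n) τ))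
        - (M.σ * w u * shiftBy (cutoffDeriv n) τ 0
          + inner ℝ (0 : DelayL2 M.r) (lpOf M.r (shiftBy (cutoffDeriv n) τ))) + _
    rw [hd0, inner_zero_left]
    ring
  have hl : Tendsto (fun n => inner ℝ (Z t) (stateOf M.r (shiftBy (cutoff n) 0))) atTop
      (𝓝 ((Y t).fst - M.σ * w t)) := by
    have := tendsto_inner_cutoff (Z t) le_rfl
    rwa [kern_zero] at this
  have hR : Tendsto (fun n => ∫ u in s..t,
      inner ℝ (C u) (stateOf M.r (shiftBy (cutoff n) (t - u)))) atTop
      (𝓝 (∫ u in s..t, ((Y u).fst * kern M.coeffA (t - u) + z u * kern M.coeffB (t - u)))) := by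
    have hc1 (n : ℕ) : Continuous fun u => stateOf M.r (shiftBy (cutoff n) (t - u)) := by
      obtain ⟨L, hL⟩ := exists_lipschitzWith_cutoffDeriv n
      have : Continuous fun τ => stateOf M.r (shiftBy (cutoff n) τ) :=
        continuous_iff_continuousAt.2 fun τ =>
          (hasDerivAt_stateOf_shiftBy hr (hasDerivAt_cutoff n) hL τ).continuousAt
      exact this.comp (by fun_prop)
    have hIoc : uIoc s t = Ioc s t := uIoc_of_le hst
    refine intervalIntegral.tendsto_integral_filter_of_dominated_convergence
      (fun _ => b * (|M.coeffA.fst| + ∫ ξ, |zext M.coeffA.snd ξ|)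
        + c * (|M.coeffB.fst| + ∫ ξ, |zext M.coeffB.snd ξ|)) (.of_forall fun n => ?_)
      (.of_forall fun n => .of_forall fun u hu => ?_) intervalIntegrable_const
      (.of_forall fun u hu => ?_)
    · rw [hIoc]
      exact (hCm.mono_measure (Measure.restrict_mono Ioc_subset_Icc_self le_rfl)).inner
        (hc1 n).aestronglyMeasurable
    · rw [hIoc] at hu
      have hu' := Ioc_subset_Icc_self hu
      simp only [C]
      rw [inner_add_left, real_inner_smul_left, real_inner_smul_left]
      refine (norm_add_le _ _).trans ?_
      rw [norm_mul, norm_mul]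
      have h1 := hb u hu'
      have h2 : ‖z u‖ ≤ c := hzb u hu'
      have h3 := abs_inner_cutoff_le M.coeffA n (t - u)
      have h4 := abs_inner_cutoff_le M.coeffB n (t - u)
      exact add_le_add (mul_le_mul h1 h3 (norm_nonneg _) ((norm_nonneg _).trans h1))
        (mul_le_mul h2 h4 (norm_nonneg _) ((norm_nonneg _).trans h2))
    · rw [hIoc] at hu
      have h0 : 0 ≤ t - u := sub_nonneg.2 hu.2
      simp only [C, inner_add_left, real_inner_smul_left]
      exact ((tendsto_inner_cutoff _ h0).const_mul _).add ((tendsto_inner_cutoff _ h0).const_mul _)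
  have hx := tendsto_inner_cutoff x (sub_nonneg.2 hst)
  have := tendsto_nhds_unique hl ((hx.add hR).congr fun n => (key n).symm)
  linarith

end GoodwillModel

/-! ### Existence of weak solutions -/

section Curve

open Filter Topology

variable {r : ℝ}

/-- The translate `ξ ↦ a (ξ - τ)` of the extension by zero of `a`, restricted to `[-r,0]`. -/
def transl (a : DelayL2 r) (τ : ℝ) : DelayL2 r :=
  LpToLpRestrictCLM ℝ ℝ ℝ volume 2 (Icc (-r) 0)
    (Lp.compMeasurePreserving (fun ξ => ξ - τ) (measurePreserving_sub_right volume τ)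
      (memLp_zext a).toLp)

lemma coeFn_transl (a : DelayL2 r) (τ : ℝ) :
    transl a τ =ᵐ[volume.restrict (Icc (-r) 0)] fun ξ => zext a (ξ - τ) := by
  have h1 := (measurePreserving_sub_right (volume : Measure ℝ) τ).quasiMeasurePreserving.ae_eq_comp
    (memLp_zext a).coeFn_toLp
  have h2 := Lp.coeFn_compMeasurePreserving (memLp_zext a).toLp
    (measurePreserving_sub_right (volume : Measure ℝ) τ)
  exact (LpToLpRestrictCLM_coeFn ℝ _ _).trans (ae_restrict_of_ae (h2.trans h1))

/-- Strong continuity of translations in `L²`. -/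
lemma continuous_transl (a : DelayL2 r) : Continuous (transl a) := by
  refine (LpToLpRestrictCLM ℝ ℝ ℝ volume 2 (Icc (-r) 0)).continuous.comp ?_
  let g : C(ℝ, C(ℝ, ℝ)) :=
    (ContinuousMap.mk (fun p : ℝ × ℝ => p.2 - p.1) (by fun_prop)).curry
  exact Continuous.compMeasurePreservingLp (f := fun _ : ℝ => (memLp_zext a).toLp) (g := g)
    continuous_const g.continuous (fun τ => measurePreserving_sub_right volume τ) (by simp)

/-- The orbit of `c` under the transport semigroup on the state space. -/
def orbit (c : StateX r) (τ : ℝ) : StateX r := WithLp.toLp 2 (kern c τ, transl c.snd τ)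

lemma continuous_orbit (c : StateX r) : Continuous (orbit c) :=
  (WithLp.prod_continuous_toLp 2 ℝ (DelayL2 r)).comp
    ((continuous_kern c).prodMk (continuous_transl _))

/-- The function `ξ ↦ ∫_{ξ-τ}^ξ a`. -/
def slidingIntegral (a : DelayL2 r) (τ : ℝ) : C(ℝ, ℝ) :=
  ⟨fun ξ => ∫ ζ in (ξ - τ)..ξ, zext a ζ, by
    have h : Continuous fun x => ∫ ξ in (0 : ℝ)..x, zext a ξ :=
      intervalIntegral.continuous_primitive (fun a b => (integrable_zext _).intervalIntegrable) 0
    have e : (fun ξ => ∫ ζ in (ξ - τ)..ξ, zext a ζ)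
        = fun ξ => (∫ ζ in (0 : ℝ)..ξ, zext a ζ) - ∫ ζ in (0 : ℝ)..(ξ - τ), zext a ζ := by
      ext ξ
      rw [intervalIntegral.integral_interval_sub_left] <;>
        exact (integrable_zext _).intervalIntegrable
    rw [e]
    exact h.sub (h.comp (by fun_prop))⟩

/-- A Bochner integral of `L²` classes has no pointwise meaning, so both sides are paired with an
arbitrary `b` and Fubini is applied; the substitution `ζ = ξ - ρ` produces the sliding window. -/
lemma integral_transl (a : DelayL2 r) {τ : ℝ} :
    ∫ ρ in (0 : ℝ)..τ, transl a ρ = lpOf r (slidingIntegral a τ) := by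
  refine ext_inner_left ℝ fun b => ?_
  have hI : IntervalIntegrable (transl a) volume 0 τ := (continuous_transl a).intervalIntegrable _ _
  have h1 := (innerSL ℝ b).intervalIntegral_comp_comm hI
  simp only [innerSL_apply_apply] at h1
  have h2 (ρ : ℝ) : inner ℝ b (transl a ρ) = ∫ ξ, zext b ξ * zext a (ξ - ρ) := by
    rw [inner_lp]
    refine integral_congr_ae ?_
    filter_upwards [(ae_restrict_iff' measurableSet_Icc).1 (coeFn_transl a ρ)] with ξ hξ
    by_cases h : ξ ∈ Icc (-r) 0
    · rw [hξ h]
    · simp [zext, h]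
  have h3 : Integrable (Function.uncurry fun ρ ξ : ℝ => zext b ξ * zext a (ξ - ρ))
      (volume.prod volume) := by
    have := (integrable_zext b).convolution_integrand (ContinuousLinearMap.mul ℝ ℝ)
      (integrable_zext a).comp_neg
    refine this.congr (.of_forall fun p => ?_)
    simp [Function.uncurry]
  rw [← h1, inner_lpOf]
  simp only [h2]
  rw [intervalIntegral_integral_swap
    (h3.mono_measure (Measure.prod_mono Measure.restrict_le_self le_rfl))]
  congr 1 with ξ
  rw [intervalIntegral.integral_const_mul,
    intervalIntegral.integral_comp_sub_left (fun x => zext a x) ξ, sub_zero]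
  rfl

lemma integral_orbit_fst (c : StateX r) (τ : ℝ) :
    (∫ ρ in (0 : ℝ)..τ, orbit c ρ).fst = ∫ ρ in (0 : ℝ)..τ, kern c ρ :=
  ((WithLp.fstL 2 ℝ ℝ (DelayL2 r)).intervalIntegral_comp_comm
    ((continuous_orbit c).intervalIntegrable 0 τ)).symm

lemma integral_orbit_snd (c : StateX r) (τ : ℝ) :
    (∫ ρ in (0 : ℝ)..τ, orbit c ρ).snd = lpOf r (slidingIntegral c.snd τ) := by
  rw [← integral_transl]
  exact ((WithLp.sndL 2 ℝ ℝ (DelayL2 r)).intervalIntegral_comp_comm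
    ((continuous_orbit c).intervalIntegrable 0 τ)).symm

lemma intervalIntegral_zext_of_le (a : DelayL2 r) {x y : ℝ} (hx : x ≤ y) (hy : y ≤ -r) :
    ∫ ζ in x..y, zext a ζ = 0 := by
  refine intervalIntegral.integral_zero_ae ?_
  filter_upwards [measure_eq_zero_iff_ae_notMem.1 (measure_singleton (μ := volume) (-r))]
    with ζ hζ hm
  rw [uIoc_of_le hx] at hm
  exact indicator_of_notMem (fun h => hζ (le_antisymm (hm.2.trans hy) h.1)) _

/-- The derivative of `∫_{ξ-τ}^ξ a` is `a(ξ) - a(ξ-τ)`. At `ξ = -r` the whole window lies to the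
left of `-r`, where the extension vanishes; this is the boundary condition of the generator. -/
lemma isSobolevRep_slidingIntegral (a : DelayL2 r) {τ : ℝ} (hτ : 0 ≤ τ) :
    IsSobolevRep (lpOf r (slidingIntegral a τ)) (slidingIntegral a τ) (a - transl a τ) ∧
      slidingIntegral a τ (-r) = 0 := by
  have h0 : slidingIntegral a τ (-r) = 0 := intervalIntegral_zext_of_le a (by linarith) le_rfl
  refine ⟨⟨coeFn_lpOf _, fun ξ hξ => ?_⟩, h0⟩
  have hi {x y : ℝ} : IntervalIntegrable (zext a) volume x y :=
    (integrable_zext a).intervalIntegrable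
  have h1 : ∫ ζ in (-r)..ξ, (a - transl a τ : DelayL2 r) ζ
      = ∫ ζ in (-r)..ξ, (zext a ζ - zext a (ζ - τ)) := by
    refine intervalIntegral.integral_congr_ae ?_
    have := (ae_restrict_iff' measurableSet_Icc).1
      ((Lp.coeFn_sub a (transl a τ)).and (coeFn_transl a τ))
    filter_upwards [this] with ζ hζ hm
    rw [uIoc_of_le hξ.1] at hm
    have hm' : ζ ∈ Icc (-r) 0 := ⟨hm.1.le, hm.2.trans hξ.2⟩
    obtain ⟨e1, e2⟩ := hζ hm'
    rw [e1, Pi.sub_apply, e2]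
    simp [zext, hm']
  have hi' : IntervalIntegrable (fun ζ => zext a (ζ - τ)) volume (-r) ξ :=
    ((integrable_zext a).comp_sub_right τ).intervalIntegrable
  rw [h0, zero_add, h1, intervalIntegral.integral_sub hi hi',
    intervalIntegral.integral_comp_sub_right (fun x => zext a x) τ]
  have h2 : ∫ ζ in (-r - τ)..(-r), zext a ζ = 0 :=
    intervalIntegral_zext_of_le a (by linarith) le_rfl
  have h3 := intervalIntegral.integral_add_adjacent_intervals
    (hi (x := -r - τ) (y := -r)) (hi (y := ξ))
  have h4 := intervalIntegral.integral_add_adjacent_intervals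
    (hi (x := -r - τ) (y := ξ - τ)) (hi (y := ξ))
  change ∫ ζ in (ξ - τ)..ξ, zext a ζ = _
  linarith

end Curve

/-! ### Variation of constants in the state space -/

namespace GoodwillModel

variable {M : GoodwillModel}

/-- The integrated orbit lies in the domain of the generator. -/
lemma isGen_integral_orbit (c : StateX M.r) {τ : ℝ} (hτ : 0 ≤ τ) :
    M.IsGen (∫ ρ in (0 : ℝ)..τ, orbit c ρ)
      (orbit c τ - c + (∫ ρ in (0 : ℝ)..τ, kern c ρ) • M.coeffA) := by
  obtain ⟨h1, h2⟩ := isSobolevRep_slidingIntegral c.snd hτ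
  refine ⟨slidingIntegral c.snd τ, c.snd - transl c.snd τ, ?_, h2, ?_, ?_⟩
  · rwa [integral_orbit_snd]
  · rw [integral_orbit_fst]
    change kern c τ - c.fst + (∫ ρ in (0 : ℝ)..τ, kern c ρ) * M.a₀ =
      M.a₀ * (∫ ρ in (0 : ℝ)..τ, kern c ρ) + ∫ ζ in (0 - τ)..0, zext c.snd ζ
    rw [kern, zero_sub]
    ring
  · rw [integral_orbit_fst]
    change transl c.snd τ - c.snd + (∫ ρ in (0 : ℝ)..τ, kern c ρ) • M.a₁ = _
    abel

/-- Pairing this element with the adjoint relation identifies the first component of `A* η` as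
`⟪(a₀, a₁), η⟫`. -/
lemma isGen_one_zero : M.IsGen (WithLp.toLp 2 (1, 0)) M.coeffA := by
  refine ⟨0, 0, ⟨?_, fun ξ hξ => ?_⟩, rfl, ?_, ?_⟩
  · exact Lp.coeFn_zero _ _ _
  · have : ∫ ζ in (-M.r)..ξ, (0 : DelayL2 M.r) ζ = 0 := by
      refine intervalIntegral.integral_zero_ae ?_
      filter_upwards [(ae_restrict_iff' measurableSet_Icc).1
        (Lp.coeFn_zero ℝ 2 (volume.restrict (Icc (-M.r) 0)))] with ζ hζ hm
      rw [uIoc_of_le hξ.1] at hm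
      exact hζ ⟨hm.1.le, hm.2.trans hξ.2⟩
    change (0 : ℝ) = 0 + ∫ ζ in (-M.r)..ξ, (0 : DelayL2 M.r) ζ
    rw [this, add_zero]
  · change M.a₀ = M.a₀ * 1 + 0
    ring
  · change M.a₁ = (1 : ℝ) • M.a₁ - 0
    rw [one_smul, sub_zero]

/-- The mild solution started at `0` with constant control, built from its first component. -/
def mildPath (M : GoodwillModel) (s c : ℝ) (y w : ℝ → ℝ) (t : ℝ) : StateX M.r :=
  (∫ u in s..t, (y u • orbit M.coeffA (t - u) + c • orbit M.coeffB (t - u))) + M.G (w t)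

lemma continuous_G : Continuous M.G := by
  unfold G
  exact (WithLp.prod_continuous_toLp 2 ℝ (DelayL2 M.r)).comp (by fun_prop)

lemma continuous_mildPath_integrand {c : ℝ} {y : ℝ → ℝ} (hy : Continuous y) :
    Continuous fun p : ℝ × ℝ =>
      y p.2 • orbit M.coeffA (p.1 - p.2) + c • orbit M.coeffB (p.1 - p.2) :=
  ((hy.comp continuous_snd).smul ((continuous_orbit _).comp (by fun_prop))).add
    (((continuous_orbit _).comp (by fun_prop)).const_smul c)

lemma continuous_mildPath {s c : ℝ} {y w : ℝ → ℝ} (hy : Continuous y) (hw : Continuous w) :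
    Continuous (M.mildPath s c y w) :=
  (intervalIntegral.continuous_parametric_intervalIntegral_of_continuous (μ := volume)
    (f := fun t u => y u • orbit M.coeffA (t - u) + c • orbit M.coeffB (t - u))
    (continuous_mildPath_integrand hy) continuous_id).add (continuous_G.comp hw)

lemma inner_mildPath {s c : ℝ} {y w : ℝ → ℝ} (hy : Continuous y) (t : ℝ) (e : StateX M.r) :
    inner ℝ (M.mildPath s c y w t) e = (∫ u in s..t, (y u * inner ℝ (orbit M.coeffA (t - u)) e
      + c * inner ℝ (orbit M.coeffB (t - u)) e)) + inner ℝ (M.G (w t)) e := by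
  rw [mildPath, inner_add_left]
  congr 1
  have hc : Continuous fun u =>
      y u • orbit M.coeffA (t - u) + c • orbit M.coeffB (t - u) :=
    (continuous_mildPath_integrand hy).comp (f := fun u => (t, u)) (by fun_prop)
  rw [real_inner_comm]
  have := (innerSL ℝ e).intervalIntegral_comp_comm (hc.intervalIntegrable (μ := volume) s t)
  simp only [innerSL_apply_apply] at this
  rw [← this]
  refine intervalIntegral.integral_congr fun u _ => ?_
  simp only [inner_add_right, real_inner_smul_right, real_inner_comm e]

lemma integral_comp_sub_self (f : ℝ → ℝ) (u t : ℝ) :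
    ∫ v in u..t, f (v - u) = ∫ ρ in (0 : ℝ)..(t - u), f ρ := by
  rw [intervalIntegral.integral_comp_sub_right f u, sub_self]

/-- Variation of constants for the transport part, with `y u • M.coeffA` as a forcing term. The
Volterra hypothesis says that `y` is the first component of the path it generates, so this forcing
is the missing part of the generator. -/
lemma mildPath_eqn {s T c : ℝ} {y w : ℝ → ℝ} (hy : Continuous y) (hw : Continuous w)
    (hyv : ∀ t ∈ Icc s T, y t =
      (∫ u in s..t, (y u * kern M.coeffA (t - u) + c * kern M.coeffB (t - u))) + M.σ * w t)
    {η ζ : StateX M.r} (hηζ : M.IsGenAdjoint η ζ) {t : ℝ} (ht : t ∈ Icc s T) :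
    inner ℝ (M.mildPath s c y w t) η =
      (∫ u in s..t, (inner ℝ (M.mildPath s c y w u) ζ + inner ℝ (M.B c) η)) +
        inner ℝ (M.G (w t)) η := by
  set α := inner ℝ M.coeffA η with hα
  have hζ : ζ.fst = α := by
    have := hηζ _ _ (isGen_one_zero (M := M))
    rw [inner_state (WithLp.toLp 2 (1, 0))] at this
    rw [hα, this]
    change ζ.fst = 1 * ζ.fst + inner ℝ (0 : DelayL2 M.r) ζ.snd
    rw [inner_zero_left]; ring
  have hGζ (a : ℝ) : inner ℝ (M.G a) ζ = α * (M.σ * a) := by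
    rw [inner_state, hζ]
    change M.σ * a * α + inner ℝ (0 : DelayL2 M.r) ζ.snd = _
    rw [inner_zero_left]; ring
  -- The integrated orbit lies in `D(A)` although the orbit itself need not, so the adjoint relation
  -- is applied to the integral.
  have horb (d : StateX M.r) {τ : ℝ} (hτ : 0 ≤ τ) :
      ∫ ρ in (0 : ℝ)..τ, inner ℝ (orbit d ρ) ζ =
        inner ℝ (orbit d τ) η - inner ℝ d η + (∫ ρ in (0 : ℝ)..τ, kern d ρ) * α := by
    have h1 := hηζ _ _ (isGen_integral_orbit d hτ)
    rw [inner_add_left, inner_sub_left, real_inner_smul_left] at h1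
    have h2 := (innerSL ℝ ζ).intervalIntegral_comp_comm
      ((continuous_orbit d).intervalIntegrable (μ := volume) 0 τ)
    simp only [innerSL_apply_apply] at h2
    rw [h1, real_inner_comm, ← h2]
    simp only [real_inner_comm ζ]
  have cin (d e : StateX M.r) : Continuous fun τ => inner ℝ (orbit d τ) e :=
    (continuous_orbit d).inner continuous_const
  have cint {f g : ℝ → ℝ} (hf : Continuous f) (hg : Continuous g) :
      Continuous fun p : ℝ × ℝ => y p.2 * f (p.1 - p.2) + c * g (p.1 - p.2) :=
    ((hy.comp continuous_snd).mul (hf.comp (by fun_prop))).add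
      ((hg.comp (by fun_prop)).const_mul c)
  have tri {f g : ℝ → ℝ} (hf : Continuous f) (hg : Continuous g) :
      ∫ v in s..t, ∫ u in s..v, (y u * f (v - u) + c * g (v - u)) =
        ∫ u in s..t, (y u * (∫ ρ in (0 : ℝ)..(t - u), f ρ)
          + c * ∫ ρ in (0 : ℝ)..(t - u), g ρ) := by
    rw [intervalIntegral_triangle_swap (cint hf hg) ht.1]
    refine intervalIntegral.integral_congr fun u _ => ?_
    simp only
    rw [intervalIntegral.integral_add, intervalIntegral.integral_const_mul,
      intervalIntegral.integral_const_mul, integral_comp_sub_self, integral_comp_sub_self]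
    · exact Continuous.intervalIntegrable ((hf.comp (by fun_prop)).const_mul _) _ _
    · exact Continuous.intervalIntegrable ((hg.comp (by fun_prop)).const_mul _) _ _
  have cprim {f g : ℝ → ℝ} (hf : Continuous f) (hg : Continuous g) :
      Continuous fun v => ∫ u in s..v, (y u * f (v - u) + c * g (v - u)) :=
    intervalIntegral.continuous_parametric_intervalIntegral_of_continuous (μ := volume)
      (f := fun v u => y u * f (v - u) + c * g (v - u)) (cint hf hg) continuous_id
  have cw : Continuous fun v => M.σ * w v := hw.const_mul _
  -- Multiplied by `α`, these kernel and noise integrals are the ones that arise when the path is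
  -- paired with `ζ`; they cancel at the end.
  have hyint : ∫ v in s..t, y v =
      (∫ u in s..t, (y u * (∫ ρ in (0 : ℝ)..(t - u), kern M.coeffA ρ)
          + c * ∫ ρ in (0 : ℝ)..(t - u), kern M.coeffB ρ)) + ∫ v in s..t, M.σ * w v := by
    rw [← tri (continuous_kern _) (continuous_kern _), ← intervalIntegral.integral_add
      ((cprim (continuous_kern _) (continuous_kern _)).intervalIntegrable _ _)
      (cw.intervalIntegrable _ _)]
    refine intervalIntegral.integral_congr fun v hv => ?_
    rw [uIcc_of_le ht.1] at hv
    exact hyv v ⟨hv.1, hv.2.trans ht.2⟩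
  have hYint : ∫ v in s..t, inner ℝ (M.mildPath s c y w v) ζ =
      (∫ u in s..t, (y u * (∫ ρ in (0 : ℝ)..(t - u), inner ℝ (orbit M.coeffA ρ) ζ)
          + c * ∫ ρ in (0 : ℝ)..(t - u), inner ℝ (orbit M.coeffB ρ) ζ)) +
        α * ∫ v in s..t, M.σ * w v := by
    rw [← tri (cin _ _) (cin _ _), ← intervalIntegral.integral_const_mul,
      ← intervalIntegral.integral_add ((cprim (cin _ _) (cin _ _)).intervalIntegrable _ _)
      ((cw.const_mul α).intervalIntegrable _ _)]
    refine intervalIntegral.integral_congr fun v _ => ?_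
    simp only [inner_mildPath hy, hGζ]
  have cκ (d : StateX M.r) : Continuous fun u => ∫ ρ in (0 : ℝ)..(t - u), kern d ρ :=
    intervalIntegral.continuous_parametric_intervalIntegral_of_continuous (μ := volume)
      (f := fun _ ρ => kern d ρ) ((continuous_kern d).comp continuous_snd) (by fun_prop)
  have hexp : ∫ u in s..t, (y u * (∫ ρ in (0 : ℝ)..(t - u), inner ℝ (orbit M.coeffA ρ) ζ)
          + c * ∫ ρ in (0 : ℝ)..(t - u), inner ℝ (orbit M.coeffB ρ) ζ) =
      (∫ u in s..t, (y u * inner ℝ (orbit M.coeffA (t - u)) η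
        + c * inner ℝ (orbit M.coeffB (t - u)) η)) - (∫ u in s..t, (y u * α
        + c * inner ℝ M.coeffB η)) +
      (∫ u in s..t, (y u * (∫ ρ in (0 : ℝ)..(t - u), kern M.coeffA ρ)
          + c * ∫ ρ in (0 : ℝ)..(t - u), kern M.coeffB ρ)) * α := by
    have c1 : Continuous fun u => y u * inner ℝ (orbit M.coeffA (t - u)) η
        + c * inner ℝ (orbit M.coeffB (t - u)) η :=
      (hy.mul ((cin _ _).comp (by fun_prop))).add (((cin _ _).comp (by fun_prop)).const_mul c)
    have c2 : Continuous fun u => y u * α + c * inner ℝ M.coeffB η := by fun_prop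
    have c12 : Continuous fun u => y u * inner ℝ (orbit M.coeffA (t - u)) η
        + c * inner ℝ (orbit M.coeffB (t - u)) η - (y u * α + c * inner ℝ M.coeffB η) := c1.sub c2
    have c3 : Continuous fun u => y u * (∫ ρ in (0 : ℝ)..(t - u), kern M.coeffA ρ)
          + c * ∫ ρ in (0 : ℝ)..(t - u), kern M.coeffB ρ :=
      (hy.mul (cκ _)).add ((cκ _).const_mul c)
    rw [← intervalIntegral.integral_mul_const, ← intervalIntegral.integral_sub
      (c1.intervalIntegrable _ _) (c2.intervalIntegrable _ _),
      ← intervalIntegral.integral_add (c12.intervalIntegrable _ _)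
        ((c3.mul_const α).intervalIntegrable _ _)]
    refine intervalIntegral.integral_congr fun u hu => ?_
    rw [uIcc_of_le ht.1] at hu
    simp only [horb _ (sub_nonneg.2 hu.2)]
    ring
  have h2 : ∫ u in s..t, (y u * α + c * inner ℝ M.coeffB η) =
      (∫ u in s..t, y u) * α + (t - s) * (c * inner ℝ M.coeffB η) := by
    rw [intervalIntegral.integral_add (Continuous.intervalIntegrable (by fun_prop) _ _)
      intervalIntegrable_const, intervalIntegral.integral_mul_const,
      intervalIntegral.integral_const, smul_eq_mul]
  rw [inner_mildPath hy, intervalIntegral.integral_add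
    ((((continuous_mildPath hy hw).inner continuous_const)).intervalIntegrable _ _)
    intervalIntegrable_const, hYint, hexp, h2, hyint, intervalIntegral.integral_const, B_eq_smul,
    real_inner_smul_left, smul_eq_mul]
  ring

end GoodwillModel

/-! ### Increments of Brownian motion -/

section Increments

open Filter Topology

variable {Ω : Type*} [MeasurableSpace Ω] {P : Measure Ω}

/-- The σ-algebra is arbitrary, so that with the one at time `t` of the filtration the lemma yields
adaptedness. Projecting time onto `[s,t]` gives joint measurability from measurability on that
interval alone. -/
lemma stronglyMeasurable_intervalIntegral {Ω' E : Type*} {_ : MeasurableSpace Ω'}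
    [NormedAddCommGroup E] [NormedSpace ℝ E] {f : ℝ → Ω' → E} {s t : ℝ} (hst : s ≤ t)
    (hc : ∀ ω, Continuous fun u => f u ω) (hm : ∀ u ∈ Icc s t, StronglyMeasurable (f u)) :
    StronglyMeasurable fun ω => ∫ u in s..t, f u ω := by
  have h : StronglyMeasurable (Function.uncurry fun u ω => f (projIcc s t hst u) ω) :=
    stronglyMeasurable_uncurry_of_continuous_of_stronglyMeasurable
      (fun ω => (hc ω).comp (continuous_subtype_val.comp continuous_projIcc))
      (fun u => hm _ (projIcc s t hst u).2)
  have h2 : StronglyMeasurable fun ω =>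
      ∫ u in Ioc s t, f (projIcc s t hst u) ω := h.integral_prod_left
  convert h2 using 2 with ω
  rw [intervalIntegral.integral_of_le hst]
  refine setIntegral_congr_fun measurableSet_Ioc fun u hu => ?_
  simp only [projIcc_of_mem hst (Ioc_subset_Icc_self hu)]

lemma integrable_abs_pow_gaussianReal (v : ℝ≥0) (n : ℕ) :
    Integrable (fun x : ℝ => |x| ^ n) (gaussianReal 0 v) := by
  have h := (memLp_id_gaussianReal (μ := 0) (v := v) n).integrable_norm_pow'
  simpa using h

/-- From `|x|^n ≤ n! exp |x| ≤ n! (exp x + exp (-x))` and the Gaussian moment generating function at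
`±1`. Monotonicity in the variance makes the bound uniform over a bounded time interval. -/
lemma integral_abs_pow_gaussianReal_le (v : ℝ≥0) (n : ℕ) :
    ∫ x, |x| ^ n ∂(gaussianReal 0 v) ≤ n.factorial * (2 * Real.exp (v / 2)) := by
  have h1 := integrable_exp_mul_gaussianReal (μ := 0) (v := v) 1
  have h2 := integrable_exp_mul_gaussianReal (μ := 0) (v := v) (-1)
  have m (t : ℝ) : ∫ x, Real.exp (t * x) ∂(gaussianReal 0 v) = Real.exp (v * t ^ 2 / 2) := by
    have := congrFun (mgf_id_gaussianReal (μ := 0) (v := v)) t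
    simpa [mgf] using this
  calc ∫ x, |x| ^ n ∂(gaussianReal 0 v)
      ≤ ∫ x, n.factorial * (Real.exp (1 * x) + Real.exp (-1 * x)) ∂(gaussianReal 0 v) := by
        refine integral_mono (integrable_abs_pow_gaussianReal v n) ((h1.add h2).const_mul _)
          fun x => ?_
        have h3 := Real.pow_div_factorial_le_exp _ (abs_nonneg x) n
        rw [div_le_iff₀ (by positivity), mul_comm] at h3
        refine h3.trans ?_
        simp only [one_mul, neg_mul]
        gcongr
        exact Real.exp_abs_le x
    _ = n.factorial * (2 * Real.exp (v / 2)) := by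
        rw [integral_const_mul, integral_add h1 h2, m, m]
        norm_num [two_mul]

/-- A continuous adapted version of the increments `W t - W s` of a Brownian motion, together with
uniform bounds for the moments. -/
lemma exists_increments (W : ℝ≥0 → Ω → ℝ) (hW : ∀ t, StronglyMeasurable (W t))
    (hB : IsBrownianReal W P) (s : ℝ) (hs : 0 ≤ s) :
    ∃ w : ℝ → Ω → ℝ, (∀ ω, Continuous fun t => w t ω) ∧
      (∀ t, s ≤ t → Measurable[completedFiltration P W hW t.toNNReal] (w t)) ∧
      (∀ᵐ ω ∂P, ∀ t, w t ω = W t.toNNReal ω - W s.toNNReal ω) ∧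
      ∀ (n : ℕ) (t : ℝ), s ≤ t → Integrable (fun ω => |w t ω| ^ n) P ∧
        ∫ ω, |w t ω| ^ n ∂P ≤ n.factorial * (2 * Real.exp ((t - s) / 2)) := by
  set N : Set Ω := toMeasurable P {ω | ¬ Continuous fun t => W t ω} with hN
  have hNm : MeasurableSet N := measurableSet_toMeasurable _ _
  have hN0 : P N = 0 := by
    rw [hN, measure_toMeasurable]
    exact hB.cont
  have hNF (t : ℝ≥0) : MeasurableSet[completedFiltration P W hW t] N := by
    have h : MeasurableSpace.generateFrom {A : Set Ω | MeasurableSet A ∧ P A = 0} ≤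
        completedFiltration P W hW t := le_sup_right (a := Filtration.natural W hW t)
    exact h _ (MeasurableSpace.measurableSet_generateFrom ⟨hNm, hN0⟩)
  have hWF {t u : ℝ≥0} (htu : t ≤ u) : Measurable[completedFiltration P W hW u] (W t) := by
    have h1 := (Filtration.stronglyAdapted_natural hW t).measurable
    have h2 : Filtration.natural W hW t ≤ completedFiltration P W hW t :=
      le_sup_left (b := MeasurableSpace.generateFrom {A : Set Ω | MeasurableSet A ∧ P A = 0})
    exact (h1.mono h2 le_rfl).mono ((completedFiltration P W hW).mono htu) le_rfl
  have hae : ∀ᵐ ω ∂P, ω ∉ N := measure_eq_zero_iff_ae_notMem.1 hN0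
  have hcN : ∀ ω ∉ N, Continuous fun t => W t ω := fun ω hω => by
    by_contra h
    exact hω (subset_toMeasurable _ _ h)
  set w : ℝ → Ω → ℝ := fun t => Nᶜ.indicator fun ω => W t.toNNReal ω - W s.toNNReal ω
  have hweq : ∀ᵐ ω ∂P, ∀ t, w t ω = W t.toNNReal ω - W s.toNNReal ω := by
    filter_upwards [hae] with ω hω t
    simp [w, hω]
  refine ⟨w, fun ω => ?_, fun t ht => ?_, hweq, fun n t ht => ?_⟩
  · by_cases hω : ω ∈ N
    · simp [w, hω, continuous_const]
    · simp only [w, indicator_of_mem (show ω ∈ Nᶜ from hω)]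
      exact ((hcN ω hω).comp continuous_real_toNNReal).sub continuous_const
  · exact Measurable.indicator
      ((hWF le_rfl).sub (hWF (Real.toNNReal_le_toNNReal ht))) (hNF t.toNNReal).compl
  · have hv := hB.hasLaw_sub t.toNNReal s.toNNReal
    have hl := hv.congr (Y := w t) (by filter_upwards [hweq] with ω hω; simp [hω])
    set v := nndist t.toNNReal.1 s.toNNReal.1
    have hvt : (v : ℝ) = t - s := by
      simp only [v, coe_nndist, Real.dist_eq]
      change |(t.toNNReal : ℝ) - s.toNNReal| = _
      rw [Real.coe_toNNReal _ hs, Real.coe_toNNReal _ (hs.trans ht), abs_of_nonneg (by linarith)]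
    have hm : AEStronglyMeasurable (fun x : ℝ => |x| ^ n) (gaussianReal 0 v) :=
      (integrable_abs_pow_gaussianReal v n).aestronglyMeasurable
    constructor
    · have := integrable_abs_pow_gaussianReal v n
      rw [← hl.map_eq] at this
      exact this.comp_aemeasurable hl.aemeasurable
    · have h1 := hl.integral_comp hm
      have h2 := integral_abs_pow_gaussianReal_le v n
      rw [hvt] at h2
      exact h1.le.trans h2

/-- The moments of a time integral. -/
lemma integrable_pow_integral [IsFiniteMeasure P] {w : ℝ → Ω → ℝ} {s T c : ℝ} (hsT : s ≤ T) (n : ℕ)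
    (hc : ∀ ω, Continuous fun t => w t ω) (hm : ∀ t, s ≤ t → Measurable (w t))
    (hi : ∀ t ∈ Icc s T, Integrable (fun ω => |w t ω| ^ n) P)
    (hb : ∀ t ∈ Icc s T, ∫ ω, |w t ω| ^ n ∂P ≤ c) :
    Integrable (fun ω => (∫ u in s..T, |w u ω|) ^ n) P := by
  rcases hsT.eq_or_lt with rfl | hlt
  · simp
  -- Measurability of `w u` is known only for `u ≥ s`, so time is frozen at `s` before that.
  have hjm : StronglyMeasurable (Function.uncurry fun u ω => |w (max s u) ω| ^ n) := by
    refine stronglyMeasurable_uncurry_of_continuous_of_stronglyMeasurable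
      (fun ω => ?_) (fun u => ?_)
    · exact ((hc ω).comp (by fun_prop)).abs.pow n
    · exact ((hm _ (le_max_left _ _)).stronglyMeasurable.norm).pow n
  have hmax {u : ℝ} (hu : u ∈ Ioc s T) : max s u = u := max_eq_right hu.1.le
  have hint : Integrable (Function.uncurry fun u ω => |w (max s u) ω| ^ n)
      ((volume.restrict (Ioc s T)).prod P) := by
    rw [integrable_prod_iff hjm.aestronglyMeasurable]
    constructor
    · filter_upwards [ae_restrict_mem measurableSet_Ioc] with u hu
      simp only [Function.uncurry, hmax hu]
      exact hi u (Ioc_subset_Icc_self hu)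
    · refine Integrable.of_bound hjm.norm.integral_prod_right'.aestronglyMeasurable c ?_
      filter_upwards [ae_restrict_mem measurableSet_Ioc] with u hu
      simp only [Function.uncurry, hmax hu, norm_pow, Real.norm_eq_abs, abs_abs]
      rw [abs_of_nonneg (integral_nonneg fun ω => by positivity)]
      exact hb u (Ioc_subset_Icc_self hu)
  have hint2 := hint.integral_prod_right
  refine (hint2.const_mul ((T - s) ^ n * (T - s)⁻¹)).mono' ?_ (.of_forall fun ω => ?_)
  · exact ((stronglyMeasurable_intervalIntegral hsT (fun ω => (hc ω).abs)
      (fun u hu => (hm u hu.1).stronglyMeasurable.norm)).pow n).aestronglyMeasurable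
  -- Jensen's inequality for the average over `(s,T]` moves the power inside the integral; it needs
  -- an interval of positive length.
  · have : NeZero (volume.restrict (Ioc s T)) := ⟨by
      rw [Ne, Measure.restrict_eq_zero, Real.volume_Ioc]; simpa using hlt⟩
    have hJ := (convexOn_pow (𝕜 := ℝ) n).map_average_le (μ := volume.restrict (Ioc s T))
      (f := fun u => |w u ω|) (continuous_pow n).continuousOn isClosed_Ici
      (.of_forall fun u => mem_Ici.2 (abs_nonneg _))
      ((hc ω).abs.integrableOn_Ioc) (((hc ω).abs.pow n).integrableOn_Ioc)
    have hTs : 0 < T - s := sub_pos.2 hlt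
    rw [average_eq, average_eq] at hJ
    simp only [measureReal_restrict_apply_univ, Real.volume_real_Ioc_of_le hsT, smul_eq_mul] at hJ
    have e : ∫ u in Ioc s T, Function.uncurry (fun u ω => |w (max s u) ω| ^ n) (u, ω)
        = ∫ u in Ioc s T, |w u ω| ^ n :=
      setIntegral_congr_fun measurableSet_Ioc fun u hu => by
        simp only [Function.uncurry, hmax hu]
    have h0 : 0 ≤ ∫ u in s..T, |w u ω| :=
      intervalIntegral.integral_nonneg hsT fun u _ => abs_nonneg _
    rw [e, Real.norm_eq_abs, abs_of_nonneg (pow_nonneg h0 n), intervalIntegral.integral_of_le hsT]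
    calc (∫ u in Ioc s T, |w u ω|) ^ n
        = (T - s) ^ n * ((T - s)⁻¹ * ∫ u in Ioc s T, |w u ω|) ^ n := by
          rw [← mul_pow, ← mul_assoc, mul_inv_cancel₀ hTs.ne', one_mul]
      _ ≤ (T - s) ^ n * ((T - s)⁻¹ * ∫ u in Ioc s T, |w u ω| ^ n) := by gcongr
      _ = _ := by ring

end Increments

/-! ### A priori bounds and the objective functional -/

/-- Up to constants, solutions are dominated by this functional of the noise. -/
def noiseBound {Ω : Type*} (s T : ℝ) (w : ℝ → Ω → ℝ) (ω : Ω) : ℝ :=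
  1 + |w T ω| + ∫ u in s..T, |w u ω|

lemma one_le_noiseBound {Ω : Type*} {s T : ℝ} (hsT : s ≤ T) (w : ℝ → Ω → ℝ) (ω : Ω) :
    1 ≤ noiseBound s T w ω := by
  have : 0 ≤ ∫ u in s..T, |w u ω| := intervalIntegral.integral_nonneg hsT fun u _ => abs_nonneg _
  have := abs_nonneg (w T ω)
  unfold noiseBound
  linarith

/-- Grönwall's inequality with `|k| ≤ L` on `[0, T - s]`. The order of quantifiers matters: `C` is
chosen before the path, the noise and the forcing, hence uniformly over controls. -/
lemma exists_volterra_bound {k : ℝ → ℝ} (hk : Continuous k) (σ : ℝ) {s T : ℝ} (hsT : s ≤ T)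
    {d : ℝ} (hd : 0 ≤ d) : ∃ C, 0 ≤ C ∧ ∀ y w D : ℝ → ℝ, ContinuousOn y (Icc s T) →
      Continuous w → (∀ t ∈ Icc s T, |D t| ≤ d) →
      (∀ t ∈ Icc s T, y t = D t + (∫ u in s..t, k (t - u) * y u) + σ * w t) →
      |y T| ≤ C * (1 + |w T| + ∫ u in s..T, |w u|) := by
  obtain ⟨L, hL⟩ : ∃ L, ∀ τ ∈ Icc 0 (T - s), ‖k τ‖ ≤ L :=
    isCompact_Icc.exists_bound_of_continuousOn hk.continuousOn
  have hL0 : 0 ≤ L := (norm_nonneg _).trans (hL 0 ⟨le_rfl, by linarith⟩)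
  have hTs : 0 ≤ T - s := by linarith
  -- With `g = d + |σ| |w|`, both `g T` and the integral of `g` are at most `d + |σ|` times the
  -- noise functional, the latter with the extra factor `1 + (T - s)`.
  refine ⟨(d + |σ|) * (1 + L * (Real.exp (L * (T - s)) * (1 + (T - s)))), by positivity,
    fun y w D hy hw hD h => ?_⟩
  have hg : Continuous fun t => d + |σ| * |w t| := by fun_prop
  have hle := le_of_le_add_mul_integral (y := fun t => |y t|) (g := fun t => d + |σ| * |w t|)
    hL0 hsT hy.abs hg.continuousOn (fun t _ => by positivity) fun t ht => by
      have h1 : |∫ u in s..t, k (t - u) * y u| ≤ L * ∫ u in s..t, |y u| := by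
        rw [← intervalIntegral.integral_const_mul]
        refine intervalIntegral.norm_integral_le_of_norm_le (f := fun u => k (t - u) * y u) ht.1
          (.of_forall fun u hu => ?_) ?_
        · rw [norm_mul, Real.norm_eq_abs (y u)]
          have := hL (t - u) ⟨by linarith [hu.2], by linarith [hu.1, ht.2]⟩
          gcongr
        · exact ((hy.mono (Icc_subset_Icc_right ht.2)).abs.intervalIntegrable_of_Icc ht.1).const_mul L
      rw [h t ht]
      have h2 := hD t ht
      have h3 := abs_add_le (D t + ∫ u in s..t, k (t - u) * y u) (σ * w t)
      have h4 := abs_add_le (D t) (∫ u in s..t, k (t - u) * y u)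
      rw [abs_mul] at h3
      linarith
  have hI : ∫ u in s..T, (d + |σ| * |w u|) = d * (T - s) + |σ| * ∫ u in s..T, |w u| := by
    rw [intervalIntegral.integral_add intervalIntegrable_const
      (Continuous.intervalIntegrable (by fun_prop) _ _), intervalIntegral.integral_const_mul]
    simp [mul_comm]
  have hJ : 0 ≤ ∫ u in s..T, |w u| :=
    intervalIntegral.integral_nonneg hsT fun u _ => abs_nonneg _
  simp only [hI] at hle
  set J := ∫ u in s..T, |w u|
  set a := |w T|
  have ha : 0 ≤ a := abs_nonneg _
  have hσ : 0 ≤ |σ| := abs_nonneg _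
  have e1 : d + |σ| * a ≤ (d + |σ|) * (1 + a + J) := by
    nlinarith [mul_nonneg hd ha, mul_nonneg hd hJ, mul_nonneg hσ hJ]
  have e2 : d * (T - s) + |σ| * J ≤ (d + |σ|) * ((1 + (T - s)) * (1 + a + J)) := by
    have h1 : d * (T - s) ≤ d * ((1 + (T - s)) * (1 + a + J)) := by
      gcongr
      nlinarith [mul_nonneg hTs ha, mul_nonneg hTs hJ]
    have h2 : |σ| * J ≤ |σ| * ((1 + (T - s)) * (1 + a + J)) := by
      gcongr
      nlinarith [mul_nonneg hTs ha, mul_nonneg hTs hJ]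
    linarith
  calc |y T| ≤ _ := hle
    _ ≤ (d + |σ|) * (1 + a + J) + L * (Real.exp (L * (T - s)) *
          ((d + |σ|) * ((1 + (T - s)) * (1 + a + J)))) := by gcongr
    _ = _ := by ring

namespace GoodwillModel

variable {M : GoodwillModel} {Ω : Type*} [MeasurableSpace Ω] {P : Measure Ω} {W : ℝ≥0 → Ω → ℝ}
  {hW : ∀ t, StronglyMeasurable (W t)} {s : ℝ}

/-- Projecting time onto `[0,T]` gives a function jointly measurable on all of `ℝ × Ω`, to which
Fubini applies. -/
lemma IsControl.exists_extension {z : ℝ → Ω → ℝ} (hz : M.IsControl P W hW z) (hT : 0 ≤ M.T) :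
    ∃ g : ℝ × Ω → ℝ, Measurable g ∧ (∀ p, g p ∈ M.U) ∧
      ∀ t ∈ Icc 0 M.T, ∀ ω, z t ω = g (t, ω) := by
  refine ⟨fun p => z (projIcc 0 M.T hT p.1) p.2, ?_, fun p => hz.mem _ (projIcc 0 M.T hT p.1).2 _,
    fun t ht ω => by simp only [projIcc_of_mem hT ht]⟩
  have h : Measurable fun p : ℝ × Ω => (projIcc 0 M.T hT p.1, p.2) :=
    (continuous_projIcc.measurable.comp measurable_fst).prodMk measurable_snd
  exact hz.measurable.comp h

lemma abs_le_of_mem_U (hU₀ : 0 ≤ M.uMin) {u : ℝ} (hu : u ∈ M.U) : |u| ≤ M.uMax := by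
  rw [abs_of_nonneg (hU₀.trans hu.1)]
  exact hu.2

lemma IsControl.aestronglyMeasurable {z : ℝ → Ω → ℝ} (hz : M.IsControl P W hW z) (hT : 0 ≤ M.T)
    (hs : 0 ≤ s) (ω : Ω) :
    AEStronglyMeasurable (fun t => z t ω) (volume.restrict (Icc s M.T)) := by
  obtain ⟨g, hg, -, hzg⟩ := hz.exists_extension hT
  have h : Measurable fun t => g (t, ω) := hg.comp (measurable_id.prodMk measurable_const)
  refine h.aestronglyMeasurable.congr ?_
  filter_upwards [ae_restrict_mem measurableSet_Icc] with t ht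
  exact (hzg t ⟨hs.trans ht.1, ht.2⟩ ω).symm

lemma IsControl.integrableOn {z : ℝ → Ω → ℝ} (hz : M.IsControl P W hW z) (hT : 0 ≤ M.T)
    (hU₀ : 0 ≤ M.uMin) (hs : 0 ≤ s) (ω : Ω) : IntegrableOn (fun t => z t ω) (Icc s M.T) := by
  refine Integrable.of_bound (hz.aestronglyMeasurable hT hs ω) M.uMax ?_
  filter_upwards [ae_restrict_mem measurableSet_Icc] with t ht
  exact abs_le_of_mem_U hU₀ (hz.mem t ⟨hs.trans ht.1, ht.2⟩ ω)

lemma IsControl.combination {z₁ z₂ : ℝ → Ω → ℝ} (h₁ : M.IsControl P W hW z₁)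
    (h₂ : M.IsControl P W hW z₂) {α β : ℝ} (hα : 0 ≤ α) (hβ : 0 ≤ β) (hαβ : α + β = 1) :
    M.IsControl P W hW fun t ω => α * z₁ t ω + β * z₂ t ω where
  measurable := (h₁.measurable.const_mul α).add (h₂.measurable.const_mul β)
  adapted t ht := ((h₁.adapted t ht).const_mul α).add ((h₂.adapted t ht).const_mul β)
  mem t ht ω := (convex_Icc _ _) (h₁.mem t ht ω) (h₂.mem t ht ω) hα hβ hαβ

lemma isControl_const (hU : M.uMin ≤ M.uMax) : M.IsControl P W hW fun _ _ => M.uMin where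
  measurable := measurable_const
  adapted _ _ := measurable_const
  mem _ _ _ := ⟨le_rfl, hU⟩

/-! #### The running cost -/

lemma IsControl.exists_cost_extension {K : ℝ} {z : ℝ → Ω → ℝ} (hz : M.IsControl P W hW z)
    (hT : 0 ≤ M.T) (hU₀ : 0 ≤ M.uMin) (hh₀ : Measurable ((Ici (0 : ℝ)).domRestrict M.h₀))
    (hhK : ∀ u ∈ M.U, |M.h u| ≤ K) :
    ∃ g : ℝ × Ω → ℝ, Measurable g ∧ (∀ p, |g p| ≤ K) ∧
      ∀ t ∈ Icc 0 M.T, ∀ ω, M.h₀ (z t ω) = g (t, ω) := by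
  obtain ⟨g, hg, hgU, hzg⟩ := hz.exists_extension hT
  refine ⟨fun p => M.h₀ (g p), ?_, fun p => ?_, fun t ht ω => by rw [hzg t ht ω]⟩
  · have h1 : Measurable fun p => (⟨g p, hU₀.trans (hgU p).1⟩ : Ici (0 : ℝ)) := hg.subtype_mk
    exact hh₀.comp h1
  · have := hhK _ (hgU p)
    rwa [h, abs_neg] at this

lemma IsControl.intervalIntegrable_cost {K : ℝ} {z : ℝ → Ω → ℝ} (hz : M.IsControl P W hW z)
    (hs : s ∈ Icc 0 M.T) (hU₀ : 0 ≤ M.uMin) (hh₀ : Measurable ((Ici (0 : ℝ)).domRestrict M.h₀))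
    (hhK : ∀ u ∈ M.U, |M.h u| ≤ K) (ω : Ω) :
    IntervalIntegrable (fun t => M.h₀ (z t ω)) volume s M.T := by
  obtain ⟨g, hg, hgK, hzg⟩ := hz.exists_cost_extension (hs.1.trans hs.2) hU₀ hh₀ hhK
  rw [intervalIntegrable_iff_integrableOn_Ioc_of_le hs.2]
  have h : Measurable fun t => g (t, ω) := hg.comp (measurable_id.prodMk measurable_const)
  refine IntegrableOn.congr_fun (Integrable.of_bound h.aestronglyMeasurable K
    (.of_forall fun t => hgK _)) (fun t ht => ?_) measurableSet_Ioc
  exact (hzg t ⟨hs.1.trans ht.1.le, ht.2⟩ ω).symm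

lemma IsControl.integrable_cost [IsFiniteMeasure P] {K : ℝ} {z : ℝ → Ω → ℝ}
    (hz : M.IsControl P W hW z) (hs : s ∈ Icc 0 M.T) (hU₀ : 0 ≤ M.uMin)
    (hh₀ : Measurable ((Ici (0 : ℝ)).domRestrict M.h₀)) (hhK : ∀ u ∈ M.U, |M.h u| ≤ K) :
    Integrable (fun ω => ∫ t in s..M.T, M.h₀ (z t ω)) P := by
  obtain ⟨g, hg, hgK, hzg⟩ := hz.exists_cost_extension (hs.1.trans hs.2) hU₀ hh₀ hhK
  have e : (fun ω => ∫ t in s..M.T, M.h₀ (z t ω)) = fun ω => ∫ t in Ioc s M.T, g (t, ω) := by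
    ext ω
    rw [intervalIntegral.integral_of_le hs.2]
    exact setIntegral_congr_fun measurableSet_Ioc fun t ht => hzg t ⟨hs.1.trans ht.1.le, ht.2⟩ ω
  have hi : Integrable g ((volume.restrict (Ioc s M.T)).prod P) :=
    Integrable.of_bound hg.aestronglyMeasurable K (.of_forall hgK)
  rw [e]
  exact hi.integral_prod_right

/-! #### The objective functional -/

/-- The exponent `m` is rounded up to an integer, which is harmless because `1 + |y| ≥ 1`. Since the
noise functional is at least one, `1 + |y|` is bounded by `1 + C` times it. The resulting majorant
does not involve the control. -/
lemma integrable_reward [IsFiniteMeasure P] {K m C : ℝ} (hK : 0 ≤ K)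
    (hφ₀ : Measurable M.φ₀) (hφK : ∀ x, |M.φ₀ x| ≤ K * (1 + |x|) ^ m) (hsT : s ≤ M.T)
    {w : ℝ → Ω → ℝ} (hw : ∀ n : ℕ, Integrable (fun ω => noiseBound s M.T w ω ^ n) P)
    {y : Ω → ℝ} (hy : Measurable y) (hyw : ∀ᵐ ω ∂P, |y ω| ≤ C * noiseBound s M.T w ω) :
    Integrable (fun ω => M.φ₀ (y ω)) P ∧ ∫ ω, M.φ₀ (y ω) ∂P ≤
      ∫ ω, K * ((1 + C) ^ ⌈m⌉₊ * noiseBound s M.T w ω ^ ⌈m⌉₊) ∂P := by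
  have hi : Integrable (fun ω => K * ((1 + C) ^ ⌈m⌉₊ * noiseBound s M.T w ω ^ ⌈m⌉₊)) P :=
    ((hw _).const_mul _).const_mul K
  have hb : ∀ᵐ ω ∂P, ‖M.φ₀ (y ω)‖ ≤ K * ((1 + C) ^ ⌈m⌉₊ * noiseBound s M.T w ω ^ ⌈m⌉₊) := by
    filter_upwards [hyw] with ω hω
    refine (hφK _).trans (mul_le_mul_of_nonneg_left ?_ hK)
    have h1 : (1 : ℝ) ≤ 1 + |y ω| := by linarith [abs_nonneg (y ω)]
    have h2 := one_le_noiseBound hsT w ω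
    calc (1 + |y ω|) ^ m ≤ (1 + |y ω|) ^ (⌈m⌉₊ : ℝ) :=
          Real.rpow_le_rpow_of_exponent_le h1 (Nat.le_ceil m)
      _ = (1 + |y ω|) ^ ⌈m⌉₊ := Real.rpow_natCast _ _
      _ ≤ ((1 + C) * noiseBound s M.T w ω) ^ ⌈m⌉₊ := by
          gcongr
          linarith
      _ = _ := mul_pow _ _ _
  have hint : Integrable (fun ω => M.φ₀ (y ω)) P :=
    hi.mono' (hφ₀.comp hy).aestronglyMeasurable hb
  exact ⟨hint, integral_mono_ae hint hi (hb.mono fun ω hω => (le_abs_self _).trans hω)⟩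

lemma objective_le [IsFiniteMeasure P] {K : ℝ} {z y : ℝ → Ω → ℝ}
    (hz : M.IsControl P W hW z) (hs : s ∈ Icc 0 M.T) (hU₀ : 0 ≤ M.uMin)
    (hh₀ : Measurable ((Ici (0 : ℝ)).domRestrict M.h₀)) (hh₀_nonneg : ∀ u, 0 ≤ u → 0 ≤ M.h₀ u)
    (hhK : ∀ u ∈ M.U, |M.h u| ≤ K) (hy : Integrable (fun ω => M.φ₀ (y M.T ω)) P) :
    M.objective P s z y ≤ ∫ ω, M.φ₀ (y M.T ω) ∂P := by
  refine integral_mono (hy.sub (hz.integrable_cost hs hU₀ hh₀ hhK)) hy fun ω => ?_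
  have : 0 ≤ ∫ t in s..M.T, M.h₀ (z t ω) :=
    intervalIntegral.integral_nonneg hs.2 fun t ht =>
      hh₀_nonneg _ (hU₀.trans (hz.mem t ⟨hs.1.trans ht.1, ht.2⟩ ω).1)
  simp only
  linarith

lemma concaveOn_reward (hφ : ConcaveOn ℝ univ M.φ) : ConcaveOn ℝ univ M.φ₀ := by
  refine ⟨convex_univ, fun a _ b _ α β hα hβ hαβ => ?_⟩
  have h := hφ.2 (mem_univ (WithLp.toLp 2 (a, 0))) (mem_univ (WithLp.toLp 2 (b, 0))) hα hβ hαβ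
  exact h

lemma objective_combination [IsFiniteMeasure P] {K : ℝ} {z₁ z₂ y₁ y₂ : ℝ → Ω → ℝ}
    (hz₁ : M.IsControl P W hW z₁) (hz₂ : M.IsControl P W hW z₂) (hs : s ∈ Icc 0 M.T)
    (hU₀ : 0 ≤ M.uMin) (hh₀ : Measurable ((Ici (0 : ℝ)).domRestrict M.h₀))
    (hhK : ∀ u ∈ M.U, |M.h u| ≤ K) (hφ : ConcaveOn ℝ univ M.φ) (hh : ConcaveOn ℝ M.U M.h)
    {α β : ℝ} (hα : 0 ≤ α) (hβ : 0 ≤ β) (hαβ : α + β = 1)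
    (hy₁ : Integrable (fun ω => M.φ₀ (y₁ M.T ω)) P) (hy₂ : Integrable (fun ω => M.φ₀ (y₂ M.T ω)) P)
    (hy : Integrable (fun ω => M.φ₀ (α * y₁ M.T ω + β * y₂ M.T ω)) P) :
    α * M.objective P s z₁ y₁ + β * M.objective P s z₂ y₂ ≤
      M.objective P s (fun t ω => α * z₁ t ω + β * z₂ t ω)
        (fun t ω => α * y₁ t ω + β * y₂ t ω) := by
  have i₁ : Integrable (fun ω => M.φ₀ (y₁ M.T ω) - ∫ t in s..M.T, M.h₀ (z₁ t ω)) P :=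
    hy₁.sub (hz₁.integrable_cost hs hU₀ hh₀ hhK)
  have i₂ : Integrable (fun ω => M.φ₀ (y₂ M.T ω) - ∫ t in s..M.T, M.h₀ (z₂ t ω)) P :=
    hy₂.sub (hz₂.integrable_cost hs hU₀ hh₀ hhK)
  have hz := hz₁.combination hz₂ hα hβ hαβ
  unfold objective
  rw [← integral_const_mul, ← integral_const_mul,
    ← integral_add (i₁.const_mul α) (i₂.const_mul β)]
  refine integral_mono ((i₁.const_mul α).add (i₂.const_mul β))
    (hy.sub (hz.integrable_cost hs hU₀ hh₀ hhK)) fun ω => ?_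
  have h1 := (concaveOn_reward hφ).2 (mem_univ (y₁ M.T ω)) (mem_univ (y₂ M.T ω)) hα hβ hαβ
  have c₁ := (hz₁.intervalIntegrable_cost hs hU₀ hh₀ hhK ω).const_mul α
  have c₂ := (hz₂.intervalIntegrable_cost hs hU₀ hh₀ hhK ω).const_mul β
  have h2 : ∫ t in s..M.T, M.h₀ (α * z₁ t ω + β * z₂ t ω) ≤
      α * (∫ t in s..M.T, M.h₀ (z₁ t ω)) + β * ∫ t in s..M.T, M.h₀ (z₂ t ω) := by
    rw [← intervalIntegral.integral_const_mul, ← intervalIntegral.integral_const_mul,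
      ← intervalIntegral.integral_add c₁ c₂]
    refine intervalIntegral.integral_mono_on hs.2 (hz.intervalIntegrable_cost hs hU₀ hh₀ hhK ω)
      (c₁.add c₂) fun t ht => ?_
    have ht' : t ∈ Icc 0 M.T := ⟨hs.1.trans ht.1, ht.2⟩
    have := hh.2 (hz₁.mem t ht' ω) (hz₂.mem t ht' ω) hα hβ hαβ
    simp only [h, smul_eq_mul] at this
    linarith
  simp only [smul_eq_mul] at h1
  simp only
  linarith

end GoodwillModel

/-! ### Solutions of the two state equations -/

namespace GoodwillModel

variable {M : GoodwillModel} {Ω : Type*} [MeasurableSpace Ω] {P : Measure Ω} {W : ℝ≥0 → Ω → ℝ}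
  {hW : ∀ t, StronglyMeasurable (W t)} {s : ℝ}

/-! #### The delay equation -/

lemma integral_abs_pastPath_le (hsT : s ≤ M.T) (p : DelayL2 M.r) {f : ℝ → ℝ} {c : ℝ}
    (hf : IntegrableOn f (Icc s M.T)) (hc : ∀ t ∈ Icc s M.T, |f t| ≤ c) :
    ∫ v, |pastPath M.T s p f v| ≤ (∫ v, |pastPath M.T s p 0 v|) + c * (M.T - s) := by
  have h0 := integrable_pastPath M.T s p (f := 0) integrableOn_zero
  have h1 := (integrable_indicator_iff measurableSet_Icc).2 hf
  have h2 : ∫ v, |(Icc s M.T).indicator f v| ≤ c * (M.T - s) := by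
    have e : (fun v => |(Icc s M.T).indicator f v|) = (Icc s M.T).indicator fun v => |f v| := by
      ext v
      by_cases hv : v ∈ Icc s M.T <;> simp [hv]
    rw [e, integral_indicator measurableSet_Icc, integral_Icc_eq_integral_Ioc,
      ← intervalIntegral.integral_of_le hsT]
    calc ∫ v in s..M.T, |f v| ≤ ∫ v in s..M.T, c :=
          intervalIntegral.integral_mono_on hsT
            ((intervalIntegrable_iff_integrableOn_Icc_of_le hsT).2 hf).abs
            intervalIntegrable_const hc
      _ = c * (M.T - s) := by simp [mul_comm]
  calc ∫ v, |pastPath M.T s p f v|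
      ≤ ∫ v, (|pastPath M.T s p 0 v| + |(Icc s M.T).indicator f v|) := by
        refine integral_mono (integrable_pastPath M.T s p hf).abs (h0.abs.add h1.abs) fun v => ?_
        simp only
        rw [pastPath_eq_add]
        exact abs_add_le _ _
    _ = _ := integral_add h0.abs h1.abs
    _ ≤ _ := by gcongr

/-- A uniform bound on the contribution of the control and of the histories. -/
lemma exists_forcing_bound (hsT : s ≤ M.T) (x₁ : DelayL2 M.r) {c : ℝ} :
    ∃ d, ∀ z : ℝ → ℝ, IntegrableOn z (Icc s M.T) → (∀ t ∈ Icc s M.T, |z t| ≤ c) →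
      ∀ t ∈ Icc s M.T, |∫ u in s..t, M.forcing s x₁ z u| ≤ d := by
  refine ⟨(∫ ξ, |zext M.a₁ ξ|) * (∫ v, |pastPath M.T s x₁ 0 v|) + |M.b₀| * (c * (M.T - s)) +
    (∫ ξ, |zext M.b₁ ξ|) * ((∫ v, |pastPath M.T s M.δ 0 v|) + c * (M.T - s)),
    fun z hz hzc t ht => ?_⟩
  have hp := integrable_pastPath M.T s x₁ (f := 0) integrableOn_zero
  have hq := integrable_pastPath M.T s M.δ hz
  have h1 := integrable_corr (integrable_zext M.a₁) hp
  have h2 := integrable_corr (integrable_zext M.b₁) hq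
  have sub {f : ℝ → ℝ} (hf : IntegrableOn f (Icc s M.T)) : IntervalIntegrable f volume s t :=
    (intervalIntegrable_iff_integrableOn_Icc_of_le ht.1).2
      (hf.mono_set (Icc_subset_Icc_right ht.2))
  have split : ∫ u in s..t, M.forcing s x₁ z u =
      (∫ u in s..t, corr (zext M.a₁) (pastPath M.T s x₁ 0) u) + (∫ u in s..t, M.b₀ * z u) +
        ∫ u in s..t, corr (zext M.b₁) (pastPath M.T s M.δ z) u := by
    rw [← intervalIntegral.integral_add h1.intervalIntegrable (sub (hz.const_mul M.b₀)),
      ← intervalIntegral.integral_add (h1.intervalIntegrable.add (sub (hz.const_mul M.b₀)))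
        h2.intervalIntegrable]
    rfl
  have hcorr {f : ℝ → ℝ} (hf : Integrable f) : |∫ u in s..t, f u| ≤ ∫ u, |f u| := by
    rw [intervalIntegral.integral_of_le ht.1]
    exact (norm_integral_le_integral_norm _).trans
      (setIntegral_le_integral hf.norm (.of_forall fun u => norm_nonneg _))
  have e1 := (hcorr h1).trans (integral_abs_corr_le (integrable_zext M.a₁) hp)
  have e2 := (hcorr h2).trans (integral_abs_corr_le (integrable_zext M.b₁) hq)
  have e2' := e2.trans (mul_le_mul_of_nonneg_left (integral_abs_pastPath_le hsT M.δ hz hzc)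
    (integral_nonneg fun ξ => abs_nonneg _))
  have hc0 : 0 ≤ c := (abs_nonneg _).trans (hzc s ⟨le_rfl, hsT⟩)
  have e3 : |∫ u in s..t, M.b₀ * z u| ≤ |M.b₀| * (c * (M.T - s)) := by
    rw [intervalIntegral.integral_const_mul, abs_mul]
    gcongr
    have := intervalIntegral.norm_integral_le_of_norm_le_const (f := z) (a := s) (b := t) (C := c)
      fun u hu => by
        rw [uIoc_of_le ht.1] at hu
        exact hzc u ⟨hu.1.le, hu.2.trans ht.2⟩
    refine this.trans ?_
    rw [abs_of_nonneg (by linarith [ht.1])]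
    gcongr
    exact ht.2
  rw [split]
  refine (abs_add_le _ _).trans (add_le_add ((abs_add_le _ _).trans (add_le_add e1 e3)) e2')

lemma exists_delay_bound (hr : 0 ≤ M.r) (hs : s ∈ Icc 0 M.T) (hU₀ : 0 ≤ M.uMin)
    (x : StateX M.r) {w : ℝ → Ω → ℝ} (hwc : ∀ ω, Continuous fun t => w t ω)
    (hw : ∀ᵐ ω ∂P, ∀ t, w t ω = W t.toNNReal ω - W s.toNNReal ω) :
    ∃ C, ∀ z y : ℝ → Ω → ℝ, M.IsControl P W hW z → M.IsDelaySolution P W hW s x z y →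
      ∀ᵐ ω ∂P, |y M.T ω| ≤ C * noiseBound s M.T w ω := by
  obtain ⟨d, hd⟩ := exists_forcing_bound hs.2 x.snd (c := M.uMax)
  -- The absolute value of `d` is taken only to make the forcing bound visibly nonnegative.
  obtain ⟨C, -, hC⟩ := exists_volterra_bound (continuous_kern M.coeffA) M.σ hs.2
    (d := |x.fst| + |d|) (by positivity)
  refine ⟨C, fun z y hz hy => ?_⟩
  filter_upwards [hw, hy.continuous, hy.eqn] with ω h1 h2 h3
  have hzi := hz.integrableOn (hs.1.trans hs.2) hU₀ hs.1 ω
  refine hC (fun t => y t ω) (fun t => w t ω)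
    (fun t => x.fst + ∫ u in s..t, M.forcing s x.snd (fun τ => z τ ω) u) h2 (hwc ω)
    (fun t ht => ?_) fun t ht => ?_
  · refine (abs_add_le _ _).trans ?_
    have := hd (fun τ => z τ ω) hzi
      (fun t ht => abs_le_of_mem_U hU₀ (hz.mem t ⟨hs.1.trans ht.1, ht.2⟩ ω)) t ht
    linarith [le_abs_self d]
  · rw [h3 t ht, integral_delayDrift hr x.snd hzi h2.integrableOn_Icc ht, h1]
    ring

lemma IsDelaySolution.combination (hr : 0 ≤ M.r) (hs : s ∈ Icc 0 M.T) (hU₀ : 0 ≤ M.uMin)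
    {x₁ x₂ : StateX M.r} {z₁ z₂ y₁ y₂ : ℝ → Ω → ℝ}
    (hz₁ : M.IsControl P W hW z₁) (hz₂ : M.IsControl P W hW z₂)
    (h₁ : M.IsDelaySolution P W hW s x₁ z₁ y₁) (h₂ : M.IsDelaySolution P W hW s x₂ z₂ y₂)
    {α β : ℝ} (hαβ : α + β = 1) :
    M.IsDelaySolution P W hW s (α • x₁ + β • x₂) (fun t ω => α * z₁ t ω + β * z₂ t ω)
      (fun t ω => α * y₁ t ω + β * y₂ t ω) where
  adapted t ht := ((h₁.adapted t ht).const_mul α).add ((h₂.adapted t ht).const_mul β)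
  continuous := by
    filter_upwards [h₁.continuous, h₂.continuous] with ω c₁ c₂
    exact (c₁.const_mul α).add (c₂.const_mul β)
  eqn := by
    filter_upwards [h₁.continuous, h₂.continuous, h₁.eqn, h₂.eqn] with ω c₁ c₂ e₁ e₂ t ht
    have hT := hs.1.trans hs.2
    have i₁ := hz₁.integrableOn hT hU₀ hs.1 ω
    have i₂ := hz₂.integrableOn hT hU₀ hs.1 ω
    have sub {f : ℝ → ℝ} (hf : IntegrableOn f (Icc s M.T)) : IntervalIntegrable f volume s t :=
      (intervalIntegrable_iff_integrableOn_Icc_of_le ht.1).2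
        (hf.mono_set (Icc_subset_Icc_right ht.2))
    have d₁ := sub (integrableOn_delayDrift hr x₁.snd i₁ c₁.integrableOn_Icc)
    have d₂ := sub (integrableOn_delayDrift hr x₂.snd i₂ c₂.integrableOn_Icc)
    have hd : ∫ u in s..t, M.delayDrift s (α • x₁ + β • x₂).snd
        (fun τ => α * z₁ τ ω + β * z₂ τ ω) (fun τ => α * y₁ τ ω + β * y₂ τ ω) u =
        α * (∫ u in s..t, M.delayDrift s x₁.snd (fun τ => z₁ τ ω) (fun τ => y₁ τ ω) u) +
        β * ∫ u in s..t, M.delayDrift s x₂.snd (fun τ => z₂ τ ω) (fun τ => y₂ τ ω) u := by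
      rw [← intervalIntegral.integral_const_mul, ← intervalIntegral.integral_const_mul,
        ← intervalIntegral.integral_add (d₁.const_mul α) (d₂.const_mul β)]
      refine intervalIntegral.integral_congr_ae ?_
      filter_upwards [delayDrift_combination hr x₁.snd x₂.snd i₁ i₂ c₁.integrableOn_Icc
        c₂.integrableOn_Icc hαβ] with u hu hut
      rw [uIoc_of_le ht.1] at hut
      exact hu ⟨hut.1.le, hut.2.trans ht.2⟩
    simp only [hd, e₁ t ht, e₂ t ht]
    change _ = (α * x₁.fst + β * x₂.fst) + _ + _
    -- Only the noise term fails to cancel termwise; the two coefficients add up to one copy of it,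
    -- multiplied by `α + β - 1 = 0`.
    linear_combination (-(M.σ * (W t.toNNReal ω - W s.toNNReal ω))) * hαβ + 2 *
      (M.σ * (W t.toNNReal ω - W s.toNNReal ω)) * hαβ

/-! #### The evolution equation -/

lemma inner_B (u : ℝ) (η : StateX M.r) : inner ℝ (M.B u) η = u * inner ℝ M.coeffB η := by
  rw [B_eq_smul, real_inner_smul_left]

lemma continuous_fst_state {r : ℝ} : Continuous fun x : StateX r => x.fst :=
  continuous_fst.comp (WithLp.prod_continuous_ofLp 2 ℝ (DelayL2 r))

/-- The reward sees only the first component, and by `weak_fst_eq` that component solves a Volterra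
equation with the same kernel as the delay equation; the forcing consists of `kern x` and the
control weighted by `kern M.coeffB`. -/
lemma exists_weak_bound (hr : 0 ≤ M.r) (hs : s ∈ Icc 0 M.T) (hU₀ : 0 ≤ M.uMin)
    (hU : M.uMin ≤ M.uMax)
    (x : StateX M.r) {w : ℝ → Ω → ℝ} (hwc : ∀ ω, Continuous fun t => w t ω)
    (hw : ∀ᵐ ω ∂P, ∀ t, w t ω = W t.toNNReal ω - W s.toNNReal ω) :
    ∃ C, ∀ (z : ℝ → Ω → ℝ) (Y : ℝ → Ω → StateX M.r), M.IsControl P W hW z →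
      M.IsWeakSolution P W hW s x z Y →
      ∀ᵐ ω ∂P, |(Y M.T ω).fst| ≤ C * noiseBound s M.T w ω := by
  have hTs : 0 ≤ M.T - s := sub_nonneg.2 hs.2
  obtain ⟨p, hp⟩ : ∃ p, ∀ τ ∈ Icc 0 (M.T - s), ‖kern x τ‖ ≤ p :=
    isCompact_Icc.exists_bound_of_continuousOn (continuous_kern x).continuousOn
  obtain ⟨q, hq⟩ : ∃ q, ∀ τ ∈ Icc 0 (M.T - s), ‖kern M.coeffB τ‖ ≤ q :=
    isCompact_Icc.exists_bound_of_continuousOn (continuous_kern M.coeffB).continuousOn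
  have hp0 : 0 ≤ p := (norm_nonneg _).trans (hp 0 ⟨le_rfl, hTs⟩)
  have hq0 : 0 ≤ q := (norm_nonneg _).trans (hq 0 ⟨le_rfl, hTs⟩)
  have hu0 : 0 ≤ M.uMax := hU₀.trans hU
  obtain ⟨C, -, hC⟩ := exists_volterra_bound (continuous_kern M.coeffA) M.σ hs.2
    (d := p + M.uMax * q * (M.T - s)) (by positivity)
  refine ⟨C, fun z Y hz hY => ?_⟩
  filter_upwards [hw, hY.continuous, hY.eqn] with ω h1 h2 h3
  have hzi := hz.integrableOn (hs.1.trans hs.2) hU₀ hs.1 ω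
  have hzU : ∀ t ∈ Icc s M.T, |z t ω| ≤ M.uMax := fun t ht =>
    abs_le_of_mem_U hU₀ (hz.mem t ⟨hs.1.trans ht.1, ht.2⟩ ω)
  have hfst : ContinuousOn (fun t => (Y t ω).fst) (Icc s M.T) :=
    continuous_fst_state.comp_continuousOn h2
  refine hC (fun t => (Y t ω).fst) (fun t => w t ω)
    (fun t => kern x (t - s) + ∫ u in s..t, z u ω * kern M.coeffB (t - u)) hfst (hwc ω)
    (fun t ht => ?_) fun t ht => ?_
  · refine (abs_add_le _ _).trans (add_le_add (hp _ ⟨by linarith [ht.1], by linarith [ht.2]⟩) ?_)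
    have := intervalIntegral.norm_integral_le_of_norm_le_const
      (f := fun u => z u ω * kern M.coeffB (t - u)) (a := s) (b := t) (C := M.uMax * q)
      fun u hu => by
        rw [uIoc_of_le ht.1] at hu
        rw [norm_mul]
        exact mul_le_mul (hzU u ⟨hu.1.le, hu.2.trans ht.2⟩)
          (hq _ ⟨by linarith [hu.2], by linarith [hu.1, ht.2]⟩) (norm_nonneg _) hu0
    refine this.trans ?_
    rw [abs_of_nonneg (by linarith [ht.1])]
    gcongr
    exact ht.2
  · have hsub : Icc s t ⊆ Icc s M.T := Icc_subset_Icc_right ht.2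
    have hzt : IntervalIntegrable (fun u => z u ω) volume s t :=
      (intervalIntegrable_iff_integrableOn_Icc_of_le ht.1).2 (hzi.mono_set hsub)
    have hk (d : StateX M.r) : Continuous fun u => kern d (t - u) :=
      (continuous_kern d).comp (by fun_prop)
    have := weak_fst_eq hr ht.1 (h2.mono hsub) (hwc ω).continuousOn
      (hzi.aestronglyMeasurable.mono_measure (Measure.restrict_mono hsub le_rfl))
      (fun u hu => hzU u (hsub hu)) (x := x) (w := fun t => w t ω) fun η ζ hηζ v hv => by
        rw [h3 η ζ hηζ v (hsub hv), h1]
    have i₁ : IntervalIntegrable (fun u => (Y u ω).fst * kern M.coeffA (t - u)) volume s t :=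
      ((hfst.mono hsub).mul (hk _).continuousOn).intervalIntegrable_of_Icc ht.1
    rw [intervalIntegral.integral_add i₁ (hzt.mul_continuousOn (hk _).continuousOn)] at this
    simp only [this, mul_comm (kern M.coeffA _)]
    ring

lemma IsWeakSolution.combination (hs : s ∈ Icc 0 M.T) (hU₀ : 0 ≤ M.uMin)
    {x₁ x₂ : StateX M.r} {z₁ z₂ : ℝ → Ω → ℝ} {Y₁ Y₂ : ℝ → Ω → StateX M.r}
    (hz₁ : M.IsControl P W hW z₁) (hz₂ : M.IsControl P W hW z₂)
    (h₁ : M.IsWeakSolution P W hW s x₁ z₁ Y₁) (h₂ : M.IsWeakSolution P W hW s x₂ z₂ Y₂)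
    {α β : ℝ} (hαβ : α + β = 1) :
    M.IsWeakSolution P W hW s (α • x₁ + β • x₂) (fun t ω => α * z₁ t ω + β * z₂ t ω)
      (fun t ω => α • Y₁ t ω + β • Y₂ t ω) where
  adapted t ht := ((h₁.adapted t ht).const_smul α).add ((h₂.adapted t ht).const_smul β)
  continuous := by
    filter_upwards [h₁.continuous, h₂.continuous] with ω c₁ c₂
    exact (c₁.const_smul α).add (c₂.const_smul β)
  eqn := by
    filter_upwards [h₁.continuous, h₂.continuous, h₁.eqn, h₂.eqn] with ω c₁ c₂ e₁ e₂ η ζ hηζ t ht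
    have hT := hs.1.trans hs.2
    have sub {f : ℝ → ℝ} (hf : IntegrableOn f (Icc s M.T)) : IntervalIntegrable f volume s t :=
      (intervalIntegrable_iff_integrableOn_Icc_of_le ht.1).2
        (hf.mono_set (Icc_subset_Icc_right ht.2))
    have i {Y : ℝ → Ω → StateX M.r} {z : ℝ → Ω → ℝ} (hz : M.IsControl P W hW z)
        (hY : ContinuousOn (fun t => Y t ω) (Icc s M.T)) : IntervalIntegrable
          (fun u => inner ℝ (Y u ω) ζ + inner ℝ (M.B (z u ω)) η) volume s t := by
      refine sub (IntegrableOn.add ?_ ?_)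
      · exact (ContinuousOn.inner (𝕜 := ℝ) hY continuousOn_const).integrableOn_Icc
      · simp only [inner_B]
        exact (hz.integrableOn hT hU₀ hs.1 ω).mul_const _
    have hd : ∫ u in s..t, (inner ℝ (α • Y₁ u ω + β • Y₂ u ω) ζ +
          inner ℝ (M.B (α * z₁ u ω + β * z₂ u ω)) η) =
        α * (∫ u in s..t, (inner ℝ (Y₁ u ω) ζ + inner ℝ (M.B (z₁ u ω)) η)) +
        β * ∫ u in s..t, (inner ℝ (Y₂ u ω) ζ + inner ℝ (M.B (z₂ u ω)) η) := by
      rw [← intervalIntegral.integral_const_mul, ← intervalIntegral.integral_const_mul,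
        ← intervalIntegral.integral_add ((i hz₁ c₁).const_mul α) ((i hz₂ c₂).const_mul β)]
      refine intervalIntegral.integral_congr fun u _ => ?_
      simp only [inner_add_left, real_inner_smul_left, inner_B]
      ring
    rw [hd, inner_add_left, inner_add_left, real_inner_smul_left, real_inner_smul_left,
      real_inner_smul_left, real_inner_smul_left, e₁ η ζ hηζ t ht, e₂ η ζ hηζ t ht]
    linear_combination (inner ℝ (M.G (W t.toNNReal ω - W s.toNNReal ω)) η) * hαβ

/-! #### Existence -/

/-- An adapted process solving the Volterra equation along every path. -/
lemma exists_adapted_volterra (hs : s ∈ Icc 0 M.T) {w : ℝ → Ω → ℝ}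
    (hwc : ∀ ω, Continuous fun t => w t ω)
    (hwm : ∀ t, s ≤ t → Measurable[completedFiltration P W hW t.toNNReal] (w t))
    {D : ℝ → ℝ} (hD : Continuous D) :
    ∃ y : ℝ → Ω → ℝ, (∀ ω, Continuous fun t => y t ω) ∧
      (∀ t, s ≤ t → Measurable[completedFiltration P W hW t.toNNReal] (y t)) ∧
      ∀ ω, ∀ t ∈ Icc s M.T, y t ω =
        D t + (∫ u in s..t, kern M.coeffA (t - u) * y u ω) + M.σ * w t ω := by
  obtain ⟨R, hR, hRe⟩ := exists_resolvent (continuous_kern M.coeffA) (sub_nonneg.2 hs.2)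
  set F : ℝ → Ω → ℝ := fun t ω => D t + M.σ * w t ω
  have hFc (ω : Ω) : Continuous fun t => F t ω := hD.add ((hwc ω).const_mul _)
  have hFm (t : ℝ) (ht : s ≤ t) : Measurable[completedFiltration P W hW t.toNNReal] (F t) :=
    ((hwm t ht).const_mul _).const_add _
  have hI (ω : Ω) : Continuous fun t => ∫ u in s..t, R (t - u) * F u ω :=
    intervalIntegral.continuous_parametric_intervalIntegral_of_continuous (μ := volume)
      (f := fun t u => R (t - u) * F u ω)
      ((hR.comp (by fun_prop)).mul ((hFc ω).comp continuous_snd)) continuous_id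
  refine ⟨fun t ω => F t ω + ∫ u in s..t, R (t - u) * F u ω, fun ω => (hFc ω).add (hI ω),
    fun t ht => ?_, fun ω t ht => ?_⟩
  · refine (hFm t ht).add (StronglyMeasurable.measurable ?_)
    refine stronglyMeasurable_intervalIntegral ht
      (fun ω => (hR.comp (by fun_prop)).mul (hFc ω)) fun u hu => ?_
    exact (((hFm u hu.1).mono ((completedFiltration P W hW).mono
      (Real.toNNReal_le_toNNReal hu.2)) le_rfl).const_mul _).stronglyMeasurable
  · have := volterra_of_resolvent (continuous_kern M.coeffA) hR (hFc ω) hRe ht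
    simp only [this]
    simp only [F]
    ring

lemma exists_delaySolution (hr : 0 ≤ M.r) (hs : s ∈ Icc 0 M.T) (c : ℝ) {w : ℝ → Ω → ℝ}
    (hwc : ∀ ω, Continuous fun t => w t ω)
    (hwm : ∀ t, s ≤ t → Measurable[completedFiltration P W hW t.toNNReal] (w t))
    (hw : ∀ᵐ ω ∂P, ∀ t, w t ω = W t.toNNReal ω - W s.toNNReal ω) (x : StateX M.r) :
    ∃ y, M.IsDelaySolution P W hW s x (fun _ _ => c) y := by
  have hc : IntegrableOn (fun _ : ℝ => c) (Icc s M.T) := continuous_const.integrableOn_Icc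
  have hD : Continuous fun t => x.fst + ∫ u in s..t, M.forcing s x.snd (fun _ => c) u := by
    refine continuous_const.add (intervalIntegral.continuous_primitive (fun a b => ?_) s)
    exact ((integrable_corr (integrable_zext M.a₁) (integrable_pastPath M.T s x.snd
      (f := 0) integrableOn_zero)).intervalIntegrable.add intervalIntegrable_const).add
      (integrable_corr (integrable_zext M.b₁)
        (integrable_pastPath M.T s M.δ hc)).intervalIntegrable
  obtain ⟨y, hyc, hym, hy⟩ := exists_adapted_volterra (M := M) hs hwc hwm hD
  refine ⟨y, fun t ht => hym t ht.1, .of_forall fun ω => (hyc ω).continuousOn, ?_⟩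
  filter_upwards [hw] with ω hω t ht
  rw [integral_delayDrift hr x.snd hc (hyc ω).integrableOn_Icc ht, ← hω]
  refine (hy ω t ht).trans ?_
  ring

/-- Properness needs a single point of finite value, so the initial state `0` and a constant control
suffice. -/
lemma exists_weakSolution (hs : s ∈ Icc 0 M.T) (c : ℝ) {w : ℝ → Ω → ℝ}
    (hwc : ∀ ω, Continuous fun t => w t ω)
    (hwm : ∀ t, s ≤ t → Measurable[completedFiltration P W hW t.toNNReal] (w t))
    (hw : ∀ᵐ ω ∂P, ∀ t, w t ω = W t.toNNReal ω - W s.toNNReal ω) :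
    ∃ Y, M.IsWeakSolution P W hW s 0 (fun _ _ => c) Y := by
  have hD : Continuous fun t => ∫ u in s..t, c * kern M.coeffB (t - u) :=
    intervalIntegral.continuous_parametric_intervalIntegral_of_continuous (μ := volume)
      (f := fun t u => c * kern M.coeffB (t - u))
      (((continuous_kern _).comp (by fun_prop)).const_mul c) continuous_id
  obtain ⟨y, hyc, hym, hy⟩ := exists_adapted_volterra (M := M) hs hwc hwm hD
  refine ⟨fun t ω => M.mildPath s c (fun u => y u ω) (fun u => w u ω) t, fun t ht => ?_,
    .of_forall fun ω => (continuous_mildPath (hyc ω) (hwc ω)).continuousOn, ?_⟩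
  · refine StronglyMeasurable.add (stronglyMeasurable_intervalIntegral ht.1
      (fun ω => ?_) fun u hu => ?_)
      (continuous_G.comp_stronglyMeasurable (hwm t ht.1).stronglyMeasurable)
    · exact (continuous_mildPath_integrand (M := M) (c := c) (hyc ω)).comp
        (f := fun u => (t, u)) (by fun_prop)
    · exact ((((hym u hu.1).mono ((completedFiltration P W hW).mono
        (Real.toNNReal_le_toNNReal hu.2)) le_rfl).stronglyMeasurable).smul_const _).add
          stronglyMeasurable_const
  · filter_upwards [hw] with ω hω η ζ hηζ t ht
    have h := mildPath_eqn (M := M) (c := c) (hyc ω) (hwc ω) (s := s) (T := M.T)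
      (fun t ht => by
        rw [hy ω t ht, intervalIntegral.integral_add]
        · simp only [mul_comm (y _ ω)]
          ring
        · exact Continuous.intervalIntegrable
            ((hyc ω).mul ((continuous_kern _).comp (by fun_prop))) _ _
        · exact Continuous.intervalIntegrable
            (((continuous_kern _).comp (by fun_prop)).const_mul c) _ _) hηζ ht
    rw [h, inner_zero_left, zero_add, hω]

end GoodwillModel

end

/-! ### Concavity of the value functions -/

/-- Pointwise suprema of locally bounded sets of values that are stable under convex combination
are proper concave. -/
lemma properConcave_iSup {E : Type*} [AddCommGroup E] [Module ℝ E] {S : E → Set ℝ}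
    (hbdd : ∀ x, BddAbove (S x)) (hne : ∃ x, (S x).Nonempty)
    (hcomb : ∀ ⦃x y : E⦄ ⦃c d α β : ℝ⦄, c ∈ S x → d ∈ S y → 0 ≤ α → 0 ≤ β → α + β = 1 →
      ∃ e ∈ S (α • x + β • y), α * c + β * d ≤ e) :
    ProperConcave fun x => ⨆ c ∈ S x, (c : EReal) := by
  refine ⟨fun x => ?_, ?_, ?_⟩
  · obtain ⟨b, hb⟩ := hbdd x
    have h : ⨆ c ∈ S x, (c : EReal) ≤ b := iSup₂_le fun c hc => EReal.coe_le_coe_iff.2 (hb hc)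
    exact (h.trans_lt (EReal.coe_lt_top b)).ne
  · obtain ⟨x, c, hc⟩ := hne
    refine ⟨x, fun h => ?_⟩
    have := (le_iSup₂ (f := fun c (_ : c ∈ S x) => (c : EReal)) c hc).trans h.le
    exact EReal.coe_ne_bot c (le_bot_iff.1 this)
  · rintro ⟨x, a⟩ ha ⟨y, b⟩ hb α β hα hβ hαβ
    change ((α * a + β * b : ℝ) : EReal) ≤ ⨆ c ∈ S (α • x + β • y), (c : EReal)
    change (a : EReal) ≤ ⨆ c ∈ S x, (c : EReal) at ha
    change (b : EReal) ≤ ⨆ c ∈ S y, (c : EReal) at hb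
    refine le_of_forall_lt fun q hq => ?_
    obtain ⟨q', hqq', hq'⟩ := EReal.lt_iff_exists_real_btwn.1 hq
    refine hqq'.trans_le ?_
    have hq'' : q' < α * a + β * b := EReal.coe_lt_coe_iff.1 hq'
    -- The suprema need not be attained, so elements within `ε` of `a` and `b` are chosen; since `α
    -- + β = 1`, the combined loss is less than the gap to be kept.
    set ε := α * a + β * b - q' with hε
    have hε0 : 0 < ε := sub_pos.2 hq''
    have key {u : E} {v : ℝ} (hv : (v : EReal) ≤ ⨆ c ∈ S u, (c : EReal)) :
        ∃ c ∈ S u, v - ε < c := by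
      have h : ((v - ε : ℝ) : EReal) < ⨆ c ∈ S u, (c : EReal) :=
        (EReal.coe_lt_coe_iff.2 (by linarith)).trans_le hv
      obtain ⟨c, h⟩ := lt_iSup_iff.1 h
      obtain ⟨hc, h⟩ := lt_iSup_iff.1 h
      exact ⟨c, hc, EReal.coe_lt_coe_iff.1 h⟩
    obtain ⟨c, hc, hac⟩ := key ha
    obtain ⟨d, hd, hbd⟩ := key hb
    obtain ⟨e, he, hcd⟩ := hcomb hc hd hα hβ hαβ
    refine (EReal.coe_le_coe_iff.2 ?_).trans
      (le_iSup₂ (f := fun c (_ : c ∈ S (α • x + β • y)) => (c : EReal)) e he)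
    have h1 : α * (a - ε) ≤ α * c := by gcongr
    have h2 : β * (b - ε) ≤ β * d := by gcongr
    have h3 : α * ε + β * ε = ε := by rw [← add_mul, hαβ, one_mul]
    linarith

/-- The power of the three-term sum is split twice by `(a + b)^n ≤ 2^(n-1) (a^n + b^n)`, leaving
moments of `w T` and of the time integral. -/
lemma integrable_noiseBound_pow {Ω : Type*} [MeasurableSpace Ω] {P : Measure Ω} [IsFiniteMeasure P]
    {w : ℝ → Ω → ℝ} {s T : ℝ} (hsT : s ≤ T) (hwc : ∀ ω, Continuous fun t => w t ω)
    (hm : ∀ t, s ≤ t → Measurable (w t))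
    (hmom : ∀ (n : ℕ) (t : ℝ), s ≤ t → Integrable (fun ω => |w t ω| ^ n) P ∧
        ∫ ω, |w t ω| ^ n ∂P ≤ n.factorial * (2 * Real.exp ((t - s) / 2))) (n : ℕ) :
    Integrable (fun ω => noiseBound s T w ω ^ n) P := by
  have hJ (k : ℕ) : Integrable (fun ω => (∫ u in s..T, |w u ω|) ^ k) P := by
    refine integrable_pow_integral (c := k.factorial * (2 * Real.exp ((T - s) / 2))) hsT k hwc hm
      (fun t ht => (hmom k t ht.1).1) fun t ht => (hmom k t ht.1).2.trans ?_
    gcongr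
    exact ht.2
  have hmeas : AEStronglyMeasurable (fun ω => noiseBound s T w ω) P := by
    have h1 : Integrable (fun ω => |w T ω|) P := by simpa using (hmom 1 T hsT).1
    have h2 : Integrable (fun ω => ∫ u in s..T, |w u ω|) P := by simpa using hJ 1
    exact (((integrable_const (1 : ℝ)).add h1).add h2).aestronglyMeasurable
  refine Integrable.mono' (g := fun ω => 2 ^ (n - 1) * (2 ^ (n - 1) * (1 ^ n + |w T ω| ^ n) +
    (∫ u in s..T, |w u ω|) ^ n)) ?_ (hmeas.pow n) (.of_forall fun ω => ?_)
  · exact (((integrable_const _).add (hmom n T hsT).1).const_mul _ |>.add (hJ n)).const_mul _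
  · have hJ0 : 0 ≤ ∫ u in s..T, |w u ω| :=
      intervalIntegral.integral_nonneg hsT fun u _ => abs_nonneg _
    have h0 : 0 ≤ noiseBound s T w ω := zero_le_one.trans (one_le_noiseBound hsT w ω)
    rw [norm_pow, Real.norm_of_nonneg h0]
    refine (add_pow_le (by positivity) hJ0 n).trans ?_
    gcongr
    exact add_pow_le zero_le_one (abs_nonneg _) n

/-! ### The value functions as suprema of sets of real numbers -/

namespace GoodwillModel

variable {M : GoodwillModel} {Ω : Type*} [MeasurableSpace Ω] {P : Measure Ω} {W : ℝ≥0 → Ω → ℝ}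
  {hW : ∀ t, StronglyMeasurable (W t)} {s : ℝ}

lemma value_eq_iSup (x : StateX M.r) : M.value P W hW s x =
    ⨆ c ∈ {c : ℝ | ∃ z y : ℝ → Ω → ℝ, M.IsControl P W hW z ∧ M.IsDelaySolution P W hW s x z y ∧
      M.objective P s z y = c}, (c : EReal) := by
  refine le_antisymm ?_ ?_
  · refine iSup₂_le fun z hz => iSup₂_le fun y hy => ?_
    exact le_iSup₂_of_le (M.objective P s z y) ⟨z, y, hz, hy, rfl⟩ le_rfl
  · refine iSup₂_le fun c hc => ?_
    obtain ⟨z, y, hz, hy, rfl⟩ := hc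
    exact le_iSup₂_of_le z hz (le_iSup₂_of_le y hy le_rfl)

/-- The objective in the state space depends on `Y` through its first component only, so it equals
the scalar objective and the estimates for the delay problem apply unchanged. -/
lemma valueX_eq_iSup (x : StateX M.r) : M.valueX P W hW s x =
    ⨆ c ∈ {c : ℝ | ∃ (z : ℝ → Ω → ℝ) (Y : ℝ → Ω → StateX M.r), M.IsControl P W hW z ∧
      M.IsWeakSolution P W hW s x z Y ∧ M.objective P s z (fun t ω => (Y t ω).fst) = c},
      (c : EReal) := by
  have key (z : ℝ → Ω → ℝ) (Y : ℝ → Ω → StateX M.r) :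
      M.objectiveX P s z Y = M.objective P s z fun t ω => (Y t ω).fst := by
    simp only [objectiveX, objective, φ, h, intervalIntegral.integral_neg, sub_eq_add_neg]
  refine le_antisymm ?_ ?_
  · refine iSup₂_le fun z hz => iSup₂_le fun Y hY => ?_
    rw [key]
    exact le_iSup₂_of_le (M.objective P s z fun t ω => (Y t ω).fst) ⟨z, Y, hz, hY, rfl⟩ le_rfl
  · refine iSup₂_le fun c hc => ?_
    obtain ⟨z, Y, hz, hY, rfl⟩ := hc
    rw [← key]
    exact le_iSup₂_of_le z hz (le_iSup₂_of_le Y hY le_rfl)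

lemma IsDelaySolution.measurable_terminal {x : StateX M.r} {z y : ℝ → Ω → ℝ}
    (hy : M.IsDelaySolution P W hW s x z y) (hsT : s ≤ M.T) : Measurable (y M.T) :=
  (hy.adapted _ ⟨hsT, le_rfl⟩).mono ((completedFiltration P W hW).le _) le_rfl

lemma IsWeakSolution.measurable_terminal {x : StateX M.r} {z : ℝ → Ω → ℝ}
    {Y : ℝ → Ω → StateX M.r} (hY : M.IsWeakSolution P W hW s x z Y) (hsT : s ≤ M.T) :
    Measurable fun ω => (Y M.T ω).fst :=
  (continuous_fst_state.comp_stronglyMeasurable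
    ((hY.adapted _ ⟨hsT, le_rfl⟩).mono ((completedFiltration P W hW).le _))).measurable

end GoodwillModel

theorem proposition3p2 {Ω : Type*} [MeasurableSpace Ω] (P : Measure Ω) [IsProbabilityMeasure P]
    (W : ℝ≥0 → Ω → ℝ) (hW : ∀ t, StronglyMeasurable (W t)) (hB : IsBrownianReal W P)
    (M : GoodwillModel) (hr : 0 < M.r) (hT : 0 < M.T)
    (ha₀ : M.a₀ ≤ 0) (hb₀ : 0 ≤ M.b₀) (hb₁ : 0 ≤ M.b₁) (hδ : 0 ≤ M.δ)
    (hU₀ : 0 ≤ M.uMin) (hU : M.uMin ≤ M.uMax)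
    (K m : ℝ) (hK : 0 < K) (hm : 0 ≤ m)
    (hφ₀ : Measurable M.φ₀) (hφK : ∀ x, |M.φ₀ x| ≤ K * (1 + |x|) ^ m)
    (hh₀ : Measurable ((Ici (0 : ℝ)).domRestrict M.h₀)) (hh₀_nonneg : ∀ u, 0 ≤ u → 0 ≤ M.h₀ u)
    (hhK : ∀ u ∈ M.U, |M.h u| ≤ K)
    (hφ : ConcaveOn ℝ univ M.φ) (hh : ConcaveOn ℝ M.U M.h)
    (s : ℝ) (hs : s ∈ Icc 0 M.T) :
    ProperConcave (fun x : StateX M.r => M.value P W hW s x) ∧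
      ProperConcave (fun x : StateX M.r => M.valueX P W hW s x) := by
  have hr' := hr.le
  obtain ⟨w, hwc, hwm, hw, hmom⟩ := exists_increments W hW hB s hs.1
  have hQ := integrable_noiseBound_pow hs.2 hwc
    (fun t ht => (hwm t ht).mono ((completedFiltration P W hW).le _) le_rfl) hmom
  have hreward {C : ℝ} {y : Ω → ℝ} (hy : Measurable y)
      (hyw : ∀ᵐ ω ∂P, |y ω| ≤ C * noiseBound s M.T w ω) :=
    GoodwillModel.integrable_reward hK.le hφ₀ hφK hs.2 hQ hy hyw
  have hconst : M.IsControl P W hW fun _ _ => M.uMin := GoodwillModel.isControl_const hU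
  constructor
  · have hb (x : StateX M.r) := GoodwillModel.exists_delay_bound hr' hs hU₀ x hwc hw (hW := hW)
    have hint {x : StateX M.r} {z y : ℝ → Ω → ℝ} (hz : M.IsControl P W hW z)
        (hy : M.IsDelaySolution P W hW s x z y) : Integrable (fun ω => M.φ₀ (y M.T ω)) P := by
      obtain ⟨C, hC⟩ := hb x
      exact (hreward (hy.measurable_terminal hs.2) (hC z y hz hy)).1
    simp only [GoodwillModel.value_eq_iSup]
    refine properConcave_iSup (fun x => ?_) ?_ ?_
    · obtain ⟨C, hC⟩ := hb x
      refine ⟨∫ ω, K * ((1 + C) ^ ⌈m⌉₊ * noiseBound s M.T w ω ^ ⌈m⌉₊) ∂P, ?_⟩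
      rintro _ ⟨z, y, hz, hy, rfl⟩
      exact (GoodwillModel.objective_le hz hs hU₀ hh₀ hh₀_nonneg hhK (hint hz hy)).trans
        (hreward (hy.measurable_terminal hs.2) (hC z y hz hy)).2
    · obtain ⟨y, hy⟩ := GoodwillModel.exists_delaySolution (M := M) hr' hs M.uMin hwc hwm hw 0
      exact ⟨0, _, _, y, hconst, hy, rfl⟩
    · rintro x₁ x₂ _ _ α β ⟨z₁, y₁, hz₁, hy₁, rfl⟩ ⟨z₂, y₂, hz₂, hy₂, rfl⟩ hα hβ hαβ
      have hz := hz₁.combination hz₂ hα hβ hαβ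
      have hy := hy₁.combination hr' hs hU₀ hz₁ hz₂ hy₂ hαβ
      -- The combined pair is itself a solution from the combined datum, so its reward is integrable
      -- by the same a priori bound and its objective belongs to the set at that point.
      exact ⟨_, ⟨_, _, hz, hy, rfl⟩, GoodwillModel.objective_combination hz₁ hz₂ hs hU₀ hh₀ hhK
        hφ hh hα hβ hαβ (hint hz₁ hy₁) (hint hz₂ hy₂) (hint hz hy)⟩
  · have hb (x : StateX M.r) := GoodwillModel.exists_weak_bound hr' hs hU₀ hU x hwc hw (hW := hW)
    have hint {x : StateX M.r} {z : ℝ → Ω → ℝ} {Y : ℝ → Ω → StateX M.r}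
        (hz : M.IsControl P W hW z) (hY : M.IsWeakSolution P W hW s x z Y) :
        Integrable (fun ω => M.φ₀ (Y M.T ω).fst) P := by
      obtain ⟨C, hC⟩ := hb x
      exact (hreward (hY.measurable_terminal hs.2) (hC z Y hz hY)).1
    simp only [GoodwillModel.valueX_eq_iSup]
    refine properConcave_iSup (fun x => ?_) ?_ ?_
    · obtain ⟨C, hC⟩ := hb x
      refine ⟨∫ ω, K * ((1 + C) ^ ⌈m⌉₊ * noiseBound s M.T w ω ^ ⌈m⌉₊) ∂P, ?_⟩
      rintro _ ⟨z, Y, hz, hY, rfl⟩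
      exact (GoodwillModel.objective_le (y := fun t ω => (Y t ω).fst) hz hs hU₀ hh₀ hh₀_nonneg hhK
        (hint hz hY)).trans (hreward (hY.measurable_terminal hs.2) (hC z Y hz hY)).2
    · obtain ⟨Y, hY⟩ := GoodwillModel.exists_weakSolution (M := M) hs M.uMin hwc hwm hw
      exact ⟨0, _, _, Y, hconst, hY, rfl⟩
    · rintro x₁ x₂ _ _ α β ⟨z₁, Y₁, hz₁, hY₁, rfl⟩ ⟨z₂, Y₂, hz₂, hY₂, rfl⟩ hα hβ hαβ
      have hz := hz₁.combination hz₂ hα hβ hαβ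
      have hY := hY₁.combination hs hU₀ hz₁ hz₂ hY₂ hαβ
      exact ⟨_, ⟨_, _, hz, hY, rfl⟩, GoodwillModel.objective_combination hz₁ hz₂ hs hU₀ hh₀ hhK
        hφ hh hα hβ hαβ (hint hz₁ hY₁) (hint hz₂ hY₂) (hint hz hY)⟩
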